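/- Let $(M,g)$ be a compact smooth Riemannian manifold without boundary, let $0<T<\infty$, and let $u:[0,T]\to\Gamma(TM)$ be an incompressible flow, i.e. a time-dependent vector field which is smooth on $[0,T]\times M$ and satisfies $\nabla_i u^i=0$ there, where $\nabla$ is the Levi-Civita connection of $g$ (indices are raised and lowered with $g$, and repeated indices $i,j$ are summed). Then the following are equivalent. (i) $u$ extends to an Euler flow. That is, there exist an integer $m\ge 0$, smooth functions $\tilde g_{ss}\in C^\infty(M)$, $s=1,\dots,m$, with $\prod_{s=1}^m\tilde g_{ss}(x)=1$ for all $x\in M$, for which $$g_{ij}(x)\,dx^i\,dx^j+\sum_{s=1}^m\tilde g_{ss}(x)\,(d\theta^s)^2$$ is a Riemannian metric $\tilde g$ on $\tilde M=M\times(\mathbb R/\mathbb Z)^m$, and smooth functions $\tilde u^s:[0,T]\to C^\infty(M)$, $s=1,\dots,m$, such that the vector field $$\tilde u(t,(x,\theta))=u^i(t,x)\frac{\partial}{\partial x^i}+\sum_{s=1}^m\tilde u^s(t,x)\frac{\partial}{\partial\theta^s}$$ solves the Euler equations $\partial_t\tilde u+\nabla_{\tilde u}\tilde u=-\mathrm{grad}_{\tilde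 g}\,\tilde p$, $\mathrm{div}_{\tilde g}\,\tilde u=0$ on $[0,T]\times\tilde M$ (with the Levi-Civita connection of $\tilde g$) for some smooth $\tilde p:[0,T]\to C^\infty(\tilde M)$. (iii) There exist an integer $m\ge 0$, smooth functions $\tilde g^{ss}\in C^\infty(M)$ and $\rho_s:[0,T]\to C^\infty(M)$ for $s=1,\dots,m$, and a smooth function $\tilde p''':[0,T]\to C^\infty(M)$ such that on $[0,T]\times M$ $$\partial_t u_i+u^j\nabla_j u_i+\sum_{s=1}^m\rho_s\nabla_i\tilde g^{ss}=-\nabla_i\tilde p''',\qquad \partial_t\rho_s+u^j\nabla_j\rho_s=0\quad(s=1,\dots,m).$$ The integers $m$ in (i) and (iii) need not agree, and the functions $\tilde g^{ss}$ in (iii) are not required to be positive or to be related to the $\tilde g_{ss}$ in (i). Smoothness of a map on $[0,T]$ means joint smoothness in time and space up to the end points of $[0,T]$. -/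

import Mathlib

open Set
open scoped Manifold ContDiff

noncomputable section

namespace EulerExt

/-! ### The torus `(ℝ/ℤ)^m` as a smooth manifold -/

section Torus

variable {m : ℕ}

/-- The inverse of the covering map `ℝ^m → (ℝ/ℤ)^m` on the open unit box with corner `a`. -/
def torusChart (a : Fin m → ℝ) : OpenPartialHomeomorph (UnitAddTorus (Fin m)) (Fin m → ℝ) :=
  (OpenPartialHomeomorph.pi
    (fun s => AddCircle.openPartialHomeomorphCoe (1 : ℝ) (a s))).symm

/-- The corner of the unit box that is centred at a lift of `θ`. -/
def torusCorner (θ : UnitAddTorus (Fin m)) : Fin m → ℝ :=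
  fun s => (AddCircle.equivIco (1 : ℝ) 0 (θ s) : ℝ) - 1 / 2

theorem mem_torusChart_source (θ : UnitAddTorus (Fin m)) :
    θ ∈ (torusChart (torusCorner θ)).source := by
  have key : ∀ s, θ s ∈ (AddCircle.openPartialHomeomorphCoe (1 : ℝ) (torusCorner θ s)).target := by
    intro s
    have h1 : (torusCorner θ s) + 1 / 2 ∈
        (AddCircle.openPartialHomeomorphCoe (1 : ℝ) (torusCorner θ s)).source := by
      simp only [AddCircle.openPartialHomeomorphCoe_source, mem_Ioo]
      constructor <;> linarith
    have h2 := (AddCircle.openPartialHomeomorphCoe (1 : ℝ) (torusCorner θ s)).map_source h1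
    have h3 : (((torusCorner θ s) + 1 / 2 : ℝ) : UnitAddCircle) = θ s := by
      simp only [torusCorner, sub_add_cancel]
      exact (AddCircle.equivIco (1 : ℝ) 0).symm_apply_apply (θ s)
    rw [← h3]
    exact h2
  intro s _
  exact key s

/-- The charts of the torus are the local inverses of the covering map, so that the coordinate
vector fields of every chart are the standard vector fields `∂/∂θ^s`. -/
instance torusChartedSpace : ChartedSpace (Fin m → ℝ) (UnitAddTorus (Fin m)) where
  atlas := range torusChart
  chartAt θ := torusChart (torusCorner θ)
  mem_chart_source := mem_torusChart_source
  chart_mem_atlas θ := ⟨torusCorner θ, rfl⟩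

/-- Transition maps are locally translations by integer vectors. -/
theorem torus_transition_contDiffOn (a b : Fin m → ℝ) :
    ContDiffOn ℝ ∞ ((torusChart a).symm.trans (torusChart b))
      ((torusChart a).symm.trans (torusChart b)).source := by
  set f := (torusChart a).symm.trans (torusChart b) with hf
  intro x hx
  have hcoe : ∀ y ∈ f.source, ∀ s, ∃ n : ℤ, f y s = y s + n := by
    intro y hy s
    have h1 : y ∈ (torusChart a).symm.source ∧
        (torusChart a).symm y ∈ (torusChart b).source := by
      simpa [hf] using hy
    have h2 : (torusChart b).symm (f y) = (torusChart a).symm y :=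
      (torusChart b).left_inv h1.2
    have h3 : ((f y s : ℝ) : UnitAddCircle) = ((y s : ℝ) : UnitAddCircle) := congrFun h2 s
    have h4 : ((f y s - y s : ℝ) : UnitAddCircle) = 0 := by
      rw [AddCircle.coe_sub, h3, sub_self]
    obtain ⟨n, hn⟩ := (AddCircle.coe_eq_zero_iff (1 : ℝ)).1 h4
    exact ⟨n, by simp at hn; linarith⟩
  have hcont : ContinuousAt f x := f.continuousAt hx
  have hev : ∀ᶠ y in nhds x, f y = y + (f x - x) := by
    have hs : ∀ᶠ y in nhds x, y ∈ f.source := f.open_source.mem_nhds hx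
    have hc : ContinuousAt (fun y => f y - y) x := hcont.sub continuousAt_id
    have hd := Metric.continuousAt_iff'.1 hc 1 one_pos
    filter_upwards [hs, hd] with y hy hdy
    funext s
    obtain ⟨n, hn⟩ := hcoe y hy s
    obtain ⟨k, hk⟩ := hcoe x hx s
    have h5 : dist ((f y - y) s) ((f x - x) s) < 1 := lt_of_le_of_lt (dist_le_pi_dist _ _ s) hdy
    simp only [Pi.sub_apply, hn, hk, add_sub_cancel_left, Real.dist_eq] at h5
    have h6 : |n - k| < 1 := by exact_mod_cast h5
    have h7 : n = k := by
      have := Int.abs_lt_one_iff.1 h6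
      omega
    simp [hn, hk, h7]
  have hg : ContDiffAt ℝ ∞ (fun y : Fin m → ℝ => y + (f x - x)) x :=
    contDiffAt_id.add contDiffAt_const
  exact (hg.congr_of_eventuallyEq hev).contDiffWithinAt

instance torusIsManifold : IsManifold 𝓘(ℝ, Fin m → ℝ) ∞ (UnitAddTorus (Fin m)) := by
  refine isManifold_of_contDiffOn _ _ _ ?_
  rintro _ _ ⟨a, rfl⟩ ⟨b, rfl⟩
  simpa using torus_transition_contDiffOn a b

end Torus

/-! ### Riemannian geometry in local coordinates

Throughout, `M` is a manifold without boundary, and tensors are written in the coordinates of the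
preferred chart around the point `x` at which a quantity is computed.  Mathlib identifies
`TangentSpace I x` with the model space `E` through the differential of this chart, so that the
coordinates at `x` of a tangent vector `v` are `v` itself. -/

section Geometry

variable {E : Type*} [NormedAddCommGroup E] [NormedSpace ℝ E]
  {H : Type*} [TopologicalSpace H] {I : ModelWithCorners ℝ E H}
  {M : Type*} [TopologicalSpace M] [ChartedSpace H M] [IsManifold I ∞ M]

variable (I M) in
/-- Smooth Riemannian metrics on `M`. -/
abbrev Metric : Type _ :=
  Bundle.ContMDiffRiemannianMetric I ∞ E (fun x : M => TangentSpace I x)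

variable (I M) in
/-- Vector fields on `M` (smoothness is a separate condition). -/
abbrev VField : Type _ := ∀ x : M, TangentSpace I x

variable (I M) in
/-- One-forms on `M` (smoothness is a separate condition). -/
abbrev OneForm : Type _ := ∀ x : M, TangentSpace I x →L[ℝ] ℝ

/-- The differential at the point with coordinates `y` of the inverse of the chart around `x`; it
sends the coordinate vector `e_i` to `∂/∂x^i`. -/
def frame (I : ModelWithCorners ℝ E H) (x : M) (y : E) :
    E →L[ℝ] TangentSpace I ((extChartAt I x).symm y) :=
  mfderiv 𝓘(ℝ, E) I (extChartAt I x).symm y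

/-- The metric `g_{ij}(y)` in the chart around `x`. -/
def metricCoord (g : Metric I M) (x : M) (y : E) : E →L[ℝ] E →L[ℝ] ℝ :=
  ContinuousLinearMap.bilinearComp (E := E) (F := E)
    (g.inner ((extChartAt I x).symm y)) (frame I x y) (frame I x y)

/-- The components `U^i(y)` of a vector field in the chart around `x`. -/
def vfieldCoord (U : VField I M) (x : M) (y : E) : E :=
  mfderiv I 𝓘(ℝ, E) (extChartAt I x) ((extChartAt I x).symm y) (U ((extChartAt I x).symm y))

/-- The components `α_i(y)` of a one-form in the chart around `x`. -/
def oneFormCoord (α : OneForm I M) (x : M) (y : E) : E →L[ℝ] ℝ :=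
  (α ((extChartAt I x).symm y)).comp (frame I x y)

/-- The derivatives `∂_a g_{bc}` of the metric at `x`, in the chart around `x`, where `a` is the
direction of differentiation. -/
def metricDeriv (g : Metric I M) (x : M) : E →L[ℝ] E →L[ℝ] E →L[ℝ] ℝ :=
  fderiv ℝ (metricCoord g x) (extChartAt I x x)

/-- The Christoffel symbols of the first kind at `x`, in the chart around `x`, as the map sending
`c` to `(∂_a g_{bc} + ∂_b g_{ac} - ∂_c g_{ab}) / 2`, see `christoffelLower_apply`. -/
def christoffelLower (g : Metric I M) (x : M) (a b : E) : E →L[ℝ] ℝ :=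
  (1 / 2 : ℝ) • (metricDeriv g x a b + metricDeriv g x b a - ((metricDeriv g x).flip a).flip b)

theorem christoffelLower_apply (g : Metric I M) (x : M) (a b c : E) :
    christoffelLower g x a b c = (1 / 2 : ℝ) *
      (metricDeriv g x a b c + metricDeriv g x b a c - metricDeriv g x c a b) := by
  simp [christoffelLower]

/-- The Christoffel symbols `Γ^k_{ij} = g^{kl} Γ_{l,ij}` at `x`, in the chart around `x`, as the
bilinear map `(a, b) ↦ Γ^k_{ij} a^i b^j`. -/
def christoffel (g : Metric I M) (x : M) (a b : E) : E :=
  (metricCoord g x (extChartAt I x x)).inverse (christoffelLower g x a b)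

theorem christoffel_add_left (g : Metric I M) (x : M) (a a' b : E) :
    christoffel g x (a + a') b = christoffel g x a b + christoffel g x a' b := by
  rw [christoffel, christoffel, christoffel, ← map_add]
  congr 1
  ext c
  simp only [christoffelLower_apply, map_add, add_apply]
  ring

theorem christoffel_smul_left (g : Metric I M) (x : M) (r : ℝ) (a b : E) :
    christoffel g x (r • a) b = r • christoffel g x a b := by
  rw [christoffel, christoffel, ← map_smul]
  congr 1
  ext c
  simp only [christoffelLower_apply, map_smul, smul_apply, smul_eq_mul]
  ring

/-- The linear map `v^j ↦ A_j^k v^j + Γ^k_{ji} v^j U^i` at `x`, in the chart around `x`. -/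
def covCoord (g : Metric I M) (x : M) (A : E →L[ℝ] E) (U : E) : E →ₗ[ℝ] E where
  toFun v := A v + christoffel g x v U
  map_add' v v' := by
    rw [map_add, christoffel_add_left]
    abel
  map_smul' r v := by
    rw [map_smul, christoffel_smul_left, RingHom.id_apply, smul_add]

/-- The Levi-Civita covariant derivative of a vector field,
`∇_j U^k = ∂_j U^k + Γ^k_{ji} U^i`, as the linear map `v ↦ ∇_v U` at `x`. -/
def covDeriv (g : Metric I M) (U : VField I M) (x : M) :
    TangentSpace I x →ₗ[ℝ] TangentSpace I x :=
  covCoord (E := E) (I := I) g x (fderiv ℝ (vfieldCoord U x) (extChartAt I x x)) (U x)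

/-- The Levi-Civita covariant derivative of a one-form,
`∇_j α_k = ∂_j α_k - Γ^i_{jk} α_i`, as the map `(v, w) ↦ (∇_v α)(w)` at `x`. -/
def covDerivForm (g : Metric I M) (α : OneForm I M) (x : M) (v w : TangentSpace I x) : ℝ :=
  fderiv ℝ (oneFormCoord α x) (extChartAt I x x) v w -
    α x (christoffel (E := E) (I := I) g x v w)

/-- The divergence `∇_k U^k`. -/
def divergence (g : Metric I M) (U : VField I M) (x : M) : ℝ :=
  LinearMap.trace ℝ (TangentSpace I x) (covDeriv g U x)

/-- The differential of a scalar function, `∇_i f = ∂_i f`. -/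
def differential (I : ModelWithCorners ℝ E H) (f : M → ℝ) : OneForm I M :=
  fun x => mfderiv I 𝓘(ℝ, ℝ) f x

/-- Lowering an index: `U_i = g_{ij} U^j`. -/
def flat (g : Metric I M) (U : VField I M) : OneForm I M := fun x => g.inner x (U x)

/-- The gradient `∇^i f = g^{ij} ∂_j f`. -/
def gradient (g : Metric I M) (f : M → ℝ) (x : M) : TangentSpace I x :=
  (g.inner x).inverse (differential I f x)

/-! ### Flows and Euler flows on the time interval `[0, T]` -/

/-- `f : [0,T] → C^∞(M)` is smooth (jointly in time and space, up to the end points); the values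
of `f` outside `[0,T]` are irrelevant. -/
def SmoothScalar (I : ModelWithCorners ℝ E H) (T : ℝ) (f : ℝ → M → ℝ) : Prop :=
  ContMDiffOn (𝓘(ℝ, ℝ).prod I) 𝓘(ℝ, ℝ) ∞ (fun q : ℝ × M => f q.1 q.2) (Icc 0 T ×ˢ univ)

/-- `u : [0,T] → Γ(TM)` is a flow: a time-dependent vector field, smooth in time and space. -/
def IsFlow (T : ℝ) (u : ℝ → VField I M) : Prop :=
  ContMDiffOn (𝓘(ℝ, ℝ).prod I) I.tangent ∞
    (fun q : ℝ × M => (⟨q.2, u q.1 q.2⟩ : TangentBundle I M)) (Icc 0 T ×ˢ univ)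

/-- `u` is a flow and is divergence free at every point of `[0,T] × M`. -/
def IsIncompressibleFlow (g : Metric I M) (T : ℝ) (u : ℝ → VField I M) : Prop :=
  IsFlow T u ∧ ∀ t ∈ Icc 0 T, ∀ x, divergence g (u t) x = 0

/-- `∂_t u` at `(t,x)`, one-sided at the end points of `[0,T]`. -/
def timeDeriv (T : ℝ) (u : ℝ → VField I M) (t : ℝ) (x : M) : TangentSpace I x :=
  derivWithin (F := E) (fun τ => u τ x) (Icc 0 T) t

/-- `∂_t α` at `(t,x)` for a time-dependent one-form `α`. -/
def timeDerivForm (T : ℝ) (α : ℝ → OneForm I M) (t : ℝ) (x : M) : TangentSpace I x →L[ℝ] ℝ :=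
  derivWithin (F := E →L[ℝ] ℝ) (fun τ => α τ x) (Icc 0 T) t

/-- `u` is an Euler flow: for some smooth pressure `p`,
`∂_t u + ∇_u u = - grad p` and `div u = 0` on `[0,T] × M`. -/
def IsEulerFlow (g : Metric I M) (T : ℝ) (u : ℝ → VField I M) : Prop :=
  IsFlow T u ∧ ∃ p : ℝ → M → ℝ, SmoothScalar I T p ∧
    ∀ t ∈ Icc 0 T, ∀ x,
      timeDeriv T u t x + covDeriv g (u t) x (u t x) = - gradient g (p t) x ∧
      divergence g (u t) x = 0

/-! ### Extensions by a warped product with a torus -/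

/-- The model with corners of the product `M × (ℝ/ℤ)^m`. -/
abbrev extModel (I : ModelWithCorners ℝ E H) (m : ℕ) :
    ModelWithCorners ℝ (E × (Fin m → ℝ)) (ModelProd H (Fin m → ℝ)) :=
  I.prod 𝓘(ℝ, Fin m → ℝ)

/-- The tangent vector `v + ∑ s, η^s ∂/∂θ^s` of `M × (ℝ/ℤ)^m` at `(x, θ)`. -/
def extVector {m : ℕ} {x : M} (θ : UnitAddTorus (Fin m)) (v : TangentSpace I x) (η : Fin m → ℝ) :
    TangentSpace (extModel I m) ((x, θ) : M × UnitAddTorus (Fin m)) :=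
  ((v, η) : E × (Fin m → ℝ))

/-- `gt` is the metric `g_{ij}(x) dx^i dx^j + ∑ s, w_s(x) (dθ^s)^2` with `w_s` smooth and
`∏ s, w_s = 1`, so that `(M × (ℝ/ℤ)^m, gt)` is an extension of `(M, g)`. -/
def IsExtensionMetric {m : ℕ} (g : Metric I M) (w : Fin m → M → ℝ)
    (gt : Metric (extModel I m) (M × UnitAddTorus (Fin m))) : Prop :=
  (∀ s, ContMDiff I 𝓘(ℝ, ℝ) ∞ (w s)) ∧ (∀ x, ∏ s, w s x = 1) ∧
    ∀ (x : M) (θ : UnitAddTorus (Fin m)) (v v' : TangentSpace I x) (η η' : Fin m → ℝ),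
      gt.inner (x, θ) (extVector θ v η) (extVector θ v' η') =
        g.inner x v v' + ∑ s, w s x * (η s * η' s)

/-- The extension `u^i ∂/∂x^i + ∑ s, a^s(t,x) ∂/∂θ^s` of `u` with swirl coefficients `a^s`. -/
def extendedFlow {m : ℕ} (u : ℝ → VField I M) (a : Fin m → ℝ → M → ℝ) :
    ℝ → VField (extModel I m) (M × UnitAddTorus (Fin m)) :=
  fun t z => extVector z.2 (u t z.1) (fun s => a s t z.1)

/-- `u` is extendible to an Euler flow: some extension of `u`, with smooth swirl coefficients, to
some extension `M × (ℝ/ℤ)^m` of `M` is an Euler flow. -/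
def ExtendsToEulerFlow (g : Metric I M) (T : ℝ) (u : ℝ → VField I M) : Prop :=
  ∃ (m : ℕ) (w : Fin m → M → ℝ) (gt : Metric (extModel I m) (M × UnitAddTorus (Fin m)))
    (a : Fin m → ℝ → M → ℝ),
    IsExtensionMetric g w gt ∧ (∀ s, SmoothScalar I T (a s)) ∧
      IsEulerFlow gt T (extendedFlow u a)

/-- The Boussinesq-type system for `u` with unknowns `γ_s = g̃^{ss}`, `ρ_s` and `P`:
`∂_t u_i + u^j ∇_j u_i + ∑ s, ρ_s ∇_i γ_s = - ∇_i P` and `∂_t ρ_s + u^j ∇_j ρ_s = 0`. -/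
def SolvesBoussinesq {m : ℕ} (g : Metric I M) (T : ℝ) (u : ℝ → VField I M)
    (γ : Fin m → M → ℝ) (ρ : Fin m → ℝ → M → ℝ) (P : ℝ → M → ℝ) : Prop :=
  ∀ t ∈ Icc 0 T, ∀ x,
    (∀ w : TangentSpace I x,
      timeDerivForm T (fun τ => flat g (u τ)) t x w +
        covDerivForm g (flat g (u t)) x (u t x) w +
        ∑ s, ρ s t x * differential I (γ s) x w = - differential I (P t) x w) ∧
    ∀ s, derivWithin (fun τ => ρ s τ x) (Icc 0 T) t + differential I (ρ s t) x (u t x) = 0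

end Geometry

end EulerExt

end

/-! The coefficients of a warped metric with weights $w_s$ depend only on the point of $M$, so its
Christoffel symbols are explicit (`christoffel_ext`). For a field $u+\sum a^s\partial_{\theta^s}$,
lowering the index in the Euler equations (`inner_euler_ext`) splits them into $\partial_t
u_i+u^j\nabla_j u_i-\sum\tfrac12(a^s)^2\partial_i w_s=-\partial_i p$ along $M$, and
$(\partial_t+u\cdot\nabla)(w_s a^s)=-\partial_{\theta^s}p$ along the circles. The extension changes
the divergence by half the derivative of $\log\prod w_s$ along $u$, which is zero since the product
is 1 (`divergence_ext`).

From Euler to Boussinesq: the left side of the circle equation does not depend on $\theta$, while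
$p(t,x,\cdot)$ has a critical point on the compact torus; hence $\partial_{\theta^s}p=0$ and $w_s
a^s$ is transported by $u$ (`differential_torus_eq_zero`). With $\gamma_s=1/w_s$ and $\rho_s=(w_s
a^s)^2/2$, the function $\rho_s$ is transported and $\rho_s\,d\gamma_s=-\tfrac12(a^s)^2dw_s$, so the
equation along $M$ is the Boussinesq equation.

From Boussinesq to Euler: the same substitution is inverted by $w_s=1/\gamma_s$,
$a^s=\gamma_s\sqrt{2\rho_s}$, which needs $\gamma_s,\rho_s>0$. By compactness constants can be added
to make them positive; the shift of $\rho_s$ costs an exact form, absorbed in the pressure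
(`SolvesBoussinesq.shift`). One more circle, with weight $\prod\gamma_s$ and no swirl, makes the
product of the weights 1 and contributes nothing to the equations (`extendsToEulerFlow_of_pos`). -/

noncomputable section

namespace EulerExt

/-! ### Tensors in a chart, and smoothness of their components -/

section ChartCoordinates

open Bundle

set_option linter.unusedSectionVars false

variable {E : Type*} [NormedAddCommGroup E] [NormedSpace ℝ E]
  {H : Type*} [TopologicalSpace H] {I : ModelWithCorners ℝ E H}
  {M : Type*} [TopologicalSpace M] [ChartedSpace H M] [IsManifold I ∞ M]

/-- The inner product of a metric at `x`, read in the model space. -/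
def modelInner (g : Metric I M) (x : M) : E →L[ℝ] E →L[ℝ] ℝ := g.inner x

theorem modelInner_symm (g : Metric I M) (x : M) (v w : E) :
    modelInner g x v w = modelInner g x w v := g.symm x v w

theorem modelInner_pos (g : Metric I M) (x : M) (v : E) (hv : v ≠ 0) :
    0 < modelInner g x v v := g.pos x v hv

/-- A vector field, read in the model space. -/
def modelField (U : VField I M) (x : M) : E := U x

/-- A one-form, read in the model space. -/
def modelForm (α : OneForm I M) (x : M) : E →L[ℝ] ℝ := α x

/-- The differential at `p` of the chart around `x`. -/
def chartDeriv (I : ModelWithCorners ℝ E H) (x p : M) : E →L[ℝ] E :=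
  mfderiv I 𝓘(ℝ, E) (extChartAt I x) p

/-- The inverse of the differential at `p` of the chart around `x`. -/
def modelFrame (I : ModelWithCorners ℝ E H) [IsManifold I ∞ M] (x p : M) : E →L[ℝ] E :=
  (trivializationAt E (TangentSpace I) x).symmL ℝ p

theorem vfieldCoord_eq (U : VField I M) (x : M) (y : E) :
    vfieldCoord U x y =
      chartDeriv I x ((extChartAt I x).symm y) (modelField U ((extChartAt I x).symm y)) :=
  rfl

theorem chartDeriv_self (x : M) (v : E) : chartDeriv I x x v = v := by
  have : IsManifold I 1 M := .of_le (n := ∞) (by simp)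
  have h := mfderiv_extChartAt_self (I := I) (x := x)
  exact DFunLike.congr_fun h v

/-- Links the coordinate frame, a derivative of the inverse chart, to the bundle trivialization in
which smoothness of sections is expressed. Without boundary the range of the model is everything, so
the derivative within it is the full derivative. -/
theorem frame_eq_modelFrame [I.Boundaryless] {x : M} {y : E} (hy : y ∈ (extChartAt I x).target) :
    (frame I x y : E →L[ℝ] E) = modelFrame I x ((extChartAt I x).symm y) := by
  have : IsManifold I 1 M := .of_le (n := ∞) (by simp)
  have hs : (extChartAt I x).symm y ∈ (chartAt H x).source := by
    rw [← extChartAt_source (I := I)]; exact (extChartAt I x).map_target hy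
  have h := TangentBundle.symmL_trivializationAt (I := I) hs
  rw [I.range_eq_univ, mfderivWithin_univ, (extChartAt I x).right_inv hy] at h
  exact h.symm

theorem chartDeriv_modelFrame {x p : M} (hp : p ∈ (chartAt H x).source) (v : E) :
    chartDeriv I x p (modelFrame I x p v) = v := by
  have : IsManifold I 1 M := .of_le (n := ∞) (by simp)
  have h := TangentBundle.continuousLinearMapAt_trivializationAt (I := I) hp
  have h2 := (trivializationAt E (TangentSpace I) x).continuousLinearMapAt_symmL (R := ℝ)
    (b := p) (by simpa using hp) v
  rw [h] at h2
  exact h2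

theorem modelFrame_chartDeriv {x p : M} (hp : p ∈ (chartAt H x).source) (v : E) :
    modelFrame I x p (chartDeriv I x p v) = v := by
  have : IsManifold I 1 M := .of_le (n := ∞) (by simp)
  have h := TangentBundle.continuousLinearMapAt_trivializationAt (I := I) hp
  have h2 := (trivializationAt E (TangentSpace I) x).symmL_continuousLinearMapAt (R := ℝ)
    (b := p) (by simpa using hp) v
  rw [h] at h2
  exact h2

theorem modelFrame_self (x : M) (v : E) : modelFrame I x x v = v := by
  have h := modelFrame_chartDeriv (I := I) (mem_chart_source H x) v
  rwa [chartDeriv_self] at h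

theorem metricCoord_apply [I.Boundaryless] (g : Metric I M) {x : M} {y : E}
    (hy : y ∈ (extChartAt I x).target) (v w : E) :
    metricCoord g x y v w = modelInner g ((extChartAt I x).symm y)
      (modelFrame I x ((extChartAt I x).symm y) v) (modelFrame I x ((extChartAt I x).symm y) w) := by
  rw [← frame_eq_modelFrame hy]
  rfl

theorem metricCoord_self [I.Boundaryless] (g : Metric I M) (x : M) :
    metricCoord g x (extChartAt I x x) = modelInner g x := by
  ext v w
  rw [metricCoord_apply g (mem_extChartAt_target x), extChartAt_to_inv, modelFrame_self,
    modelFrame_self]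

theorem oneFormCoord_apply [I.Boundaryless] (α : OneForm I M) {x : M} {y : E}
    (hy : y ∈ (extChartAt I x).target) (v : E) :
    oneFormCoord α x y v = modelForm α ((extChartAt I x).symm y)
      (modelFrame I x ((extChartAt I x).symm y) v) := by
  rw [← frame_eq_modelFrame hy]
  rfl

theorem oneFormCoord_flat [I.Boundaryless] (g : Metric I M) (U : VField I M) {x : M} {y : E}
    (hy : y ∈ (extChartAt I x).target) :
    oneFormCoord (flat g U) x y = metricCoord g x y (vfieldCoord U x y) := by
  have hs : (extChartAt I x).symm y ∈ (chartAt H x).source := by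
    rw [← extChartAt_source (I := I)]; exact (extChartAt I x).map_target hy
  ext w
  rw [oneFormCoord_apply _ hy, metricCoord_apply _ hy, vfieldCoord_eq, modelFrame_chartDeriv hs]
  rfl

theorem vfieldCoord_self (U : VField I M) (x : M) :
    vfieldCoord U x (extChartAt I x x) = modelField U x := by
  rw [vfieldCoord_eq, extChartAt_to_inv]
  exact chartDeriv_self x _

/-- A family of bilinear forms on the tangent spaces, in the chart around `x₀`. -/
def bilinCoord (B : M → E →L[ℝ] E →L[ℝ] ℝ) (I : ModelWithCorners ℝ E H) [IsManifold I ∞ M]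
    (x₀ p : M) : E →L[ℝ] E →L[ℝ] ℝ :=
  (B p).bilinearComp (modelFrame I x₀ p) (modelFrame I x₀ p)

theorem bilinCoord_apply (B : M → E →L[ℝ] E →L[ℝ] ℝ) (x₀ p : M) (v w : E) :
    bilinCoord B I x₀ p v w = B p (modelFrame I x₀ p v) (modelFrame I x₀ p w) := rfl

/-- The trivialization of the bundle of bilinear forms is conjugation by the tangent trivialization,
the target being a trivial line bundle. One direction gives smooth components of a given metric, the
other makes the warped form a metric. -/
theorem contMDiffAt_bilin_iff
    (B : ∀ p : M, TangentSpace I p →L[ℝ] TangentSpace I p →L[ℝ] ℝ) (x₀ : M) :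
    ContMDiffAt I (I.prod 𝓘(ℝ, E →L[ℝ] E →L[ℝ] ℝ)) ∞
      (fun p ↦ TotalSpace.mk' (E →L[ℝ] E →L[ℝ] ℝ)
        (E := fun p : M => TangentSpace I p →L[ℝ] TangentSpace I p →L[ℝ] ℝ) p (B p)) x₀ ↔
      ContMDiffAt I 𝓘(ℝ, E →L[ℝ] E →L[ℝ] ℝ) ∞ (bilinCoord B I x₀) x₀ := by
  rw [contMDiffAt_section]
  apply Filter.EventuallyEq.contMDiffAt_iff
  filter_upwards [(chartAt H x₀).open_source.mem_nhds (mem_chart_source H x₀)] with p hp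
  have hb : p ∈ (trivializationAt E (TangentSpace I) x₀).baseSet := by simpa using hp
  ext v w
  rw [hom_trivializationAt_apply]
  refine (inCoordinates_apply_eq₂ (𝕜 := ℝ) (F₁ := E) (F₂ := E) (F₃ := ℝ)
    (E₁ := TangentSpace I) (E₂ := TangentSpace I) (E₃ := Bundle.Trivial M ℝ)
    (ϕ := B p) (v := v) (w := w) hb hb (by simp)).trans ?_
  refine (DFunLike.congr_fun (Bundle.Trivial.linearMapAt_trivialization ℝ M ℝ p)
    (B p ((trivializationAt E (TangentSpace I) x₀).symm p v)
      ((trivializationAt E (TangentSpace I) x₀).symm p w))).trans ?_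
  rw [LinearMap.id_apply]
  exact congrArg₂ (fun a b => B p a b)
    ((trivializationAt E (TangentSpace I) x₀).symmL_apply hb v).symm
    ((trivializationAt E (TangentSpace I) x₀).symmL_apply hb w).symm

theorem metricCoord_eventuallyEq [I.Boundaryless] (g : Metric I M) (x : M) :
    metricCoord g x =ᶠ[nhds (extChartAt I x x)]
      fun y => bilinCoord (modelInner g) I x ((extChartAt I x).symm y) := by
  filter_upwards [extChartAt_target_mem_nhds (I := I) x] with y hy
  ext v w
  rw [metricCoord_apply g hy, bilinCoord_apply]

theorem contMDiffAt_bilinCoord_metric (g : Metric I M) (x : M) :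
    ContMDiffAt I 𝓘(ℝ, E →L[ℝ] E →L[ℝ] ℝ) ∞ (bilinCoord (modelInner g) I x) x :=
  (contMDiffAt_bilin_iff g.inner x).1 (g.contMDiff x)

theorem contMDiffAt_extChartAt_symm_self [I.Boundaryless] (x : M) :
    ContMDiffAt 𝓘(ℝ, E) I ∞ (extChartAt I x).symm (extChartAt I x x) :=
  (contMDiffOn_extChartAt_symm (I := I) x).contMDiffAt (extChartAt_target_mem_nhds (I := I) x)

theorem contDiffAt_comp_extChartAt_symm [I.Boundaryless] {F : Type*} [NormedAddCommGroup F]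
    [NormedSpace ℝ F] {f : M → F} {x : M} (hf : ContMDiffAt I 𝓘(ℝ, F) ∞ f x) :
    ContDiffAt ℝ ∞ (fun y => f ((extChartAt I x).symm y)) (extChartAt I x x) := by
  rw [← contMDiffAt_iff_contDiffAt]
  refine ContMDiffAt.comp (I' := I) _ ?_ (contMDiffAt_extChartAt_symm_self x)
  rwa [extChartAt_to_inv]

theorem contDiffAt_metricCoord [I.Boundaryless] (g : Metric I M) (x : M) :
    ContDiffAt ℝ ∞ (metricCoord g x) (extChartAt I x x) :=
  (contDiffAt_comp_extChartAt_symm (contMDiffAt_bilinCoord_metric g x)).congr_of_eventuallyEq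
    (metricCoord_eventuallyEq g x)

/-- Smoothness of a vector field at a point is smoothness of its components. -/
theorem contDiffAt_vfieldCoord [I.Boundaryless] {U : VField I M} {x : M}
    (hU : ContMDiffAt I I.tangent ∞ (fun p => (⟨p, U p⟩ : TangentBundle I M)) x) :
    ContDiffAt ℝ ∞ (vfieldCoord U x) (extChartAt I x x) := by
  have : IsManifold I 1 M := .of_le (n := ∞) (by simp)
  have h := contDiffAt_comp_extChartAt_symm ((contMDiffAt_section x).1 hU)
  refine h.congr_of_eventuallyEq ?_
  filter_upwards [extChartAt_target_mem_nhds (I := I) x] with y hy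
  have hs : (extChartAt I x).symm y ∈ (chartAt H x).source := by
    rw [← extChartAt_source (I := I)]; exact (extChartAt I x).map_target hy
  have h2 := TangentBundle.continuousLinearMapAt_trivializationAt (I := I) hs
  rw [vfieldCoord, ← h2]
  have hb : (extChartAt I x).symm y ∈ (trivializationAt E (TangentSpace I) x).baseSet := by
    simpa using hs
  exact congrFun ((trivializationAt E (TangentSpace I) x).coe_linearMapAt_of_mem (R := ℝ) hb) _

end ChartCoordinates

/-! ### Nondegeneracy and the Levi-Civita connection -/

section LeviCivita

open Bundle

set_option linter.unusedSectionVars false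
set_option synthInstance.maxHeartbeats 200000

variable {E : Type*} [NormedAddCommGroup E] [NormedSpace ℝ E]
  {H : Type*} [TopologicalSpace H] {I : ModelWithCorners ℝ E H} [I.Boundaryless]
  {M : Type*} [TopologicalSpace M] [ChartedSpace H M] [IsManifold I ∞ M]

theorem modelInner_injective (g : Metric I M) (x : M) : Function.Injective (modelInner g x) := by
  rw [injective_iff_map_eq_zero]
  intro v hv
  by_contra h
  have := modelInner_pos g x v h
  simp [hv] at this

theorem modelInner_ext (g : Metric I M) (x : M) {v v' : E}
    (h : ∀ w, modelInner g x v w = modelInner g x v' w) : v = v' :=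
  modelInner_injective g x (ContinuousLinearMap.ext h)

/-- `inverse` defaults to 0 on a map that is not invertible. Here positivity gives injectivity, and
equality of dimensions with the dual gives an isomorphism. -/
theorem modelInner_inverse [FiniteDimensional ℝ E] (g : Metric I M) (x : M) (α : E →L[ℝ] ℝ) :
    modelInner g x ((modelInner g x).inverse α) = α := by
  have hd : Module.finrank ℝ E = Module.finrank ℝ (E →L[ℝ] ℝ) := by
    rw [← (LinearMap.toContinuousLinearMap (𝕜 := ℝ) (E := E) (F' := ℝ)).finrank_eq]
    exact (Subspace.dual_finrank_eq (K := ℝ) (V := E)).symm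
  let e : E ≃L[ℝ] (E →L[ℝ] ℝ) :=
    (LinearEquiv.ofInjectiveOfFinrankEq (modelInner g x : E →ₗ[ℝ] (E →L[ℝ] ℝ))
      (modelInner_injective g x) hd).toContinuousLinearEquiv
  have he : modelInner g x = e := by ext v w; rfl
  rw [he, ContinuousLinearMap.inverse_equiv]
  exact e.apply_symm_apply α

theorem inner_gradient [FiniteDimensional ℝ E] (g : Metric I M) (f : M → ℝ) (x : M) :
    modelInner g x (gradient g f x) = modelForm (differential I f) x :=
  modelInner_inverse g x (modelForm (differential I f) x)

theorem inner_christoffel [FiniteDimensional ℝ E] (g : Metric I M) (x : M) (a b c : E) :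
    modelInner g x (christoffel g x a b) c = christoffelLower g x a b c := by
  rw [christoffel, metricCoord_self, modelInner_inverse]

theorem hasFDerivAt_metricCoord (g : Metric I M) (x : M) :
    HasFDerivAt (metricCoord g x) (metricDeriv g x) (extChartAt I x x) :=
  ((contDiffAt_metricCoord g x).differentiableAt (by simp)).hasFDerivAt

theorem metricDeriv_symm (g : Metric I M) (x : M) (a b c : E) :
    metricDeriv g x a b c = metricDeriv g x a c b := by
  have h1 := ((hasFDerivAt_metricCoord g x).clm_apply (hasFDerivAt_const b _)).clm_apply
    (hasFDerivAt_const c _)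
  have h2 := ((hasFDerivAt_metricCoord g x).clm_apply (hasFDerivAt_const c _)).clm_apply
    (hasFDerivAt_const b _)
  have h3 : (fun y => metricCoord g x y b c) =ᶠ[nhds (extChartAt I x x)]
      fun y => metricCoord g x y c b := by
    filter_upwards [extChartAt_target_mem_nhds (I := I) x] with y hy
    rw [metricCoord_apply g hy, metricCoord_apply g hy, modelInner_symm]
  have h4 := DFunLike.congr_fun (h1.unique (h2.congr_of_eventuallyEq h3)) a
  simpa using h4

/-- Metric compatibility, $\partial_v g(U,w)=\Gamma_{w,vU}+\Gamma_{U,vw}$, so lowering an index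
commutes with $\nabla$. This matches the Euler equations for vectors with the Boussinesq equations
for one-forms. -/
theorem covDerivForm_flat [FiniteDimensional ℝ E] (g : Metric I M) {U : VField I M} {x : M}
    (hU : ContMDiffAt I I.tangent ∞ (fun p => (⟨p, U p⟩ : TangentBundle I M)) x) (v w : E) :
    covDerivForm g (flat g U) x v w = modelInner g x (covDeriv g U x v) w := by
  have hUd := ((contDiffAt_vfieldCoord hU).differentiableAt (by simp)).hasFDerivAt
  have h1 := ((hasFDerivAt_metricCoord g x).clm_apply hUd).clm_apply (hasFDerivAt_const w _)
  have h2 : (fun y => oneFormCoord (flat g U) x y) =ᶠ[nhds (extChartAt I x x)]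
      fun y => metricCoord g x y (vfieldCoord U x y) := by
    filter_upwards [extChartAt_target_mem_nhds (I := I) x] with y hy
    exact oneFormCoord_flat g U hy
  have h3 := ((hasFDerivAt_metricCoord g x).clm_apply hUd).congr_of_eventuallyEq h2
  have h4 : fderiv ℝ (oneFormCoord (flat g U) x) (extChartAt I x x) v w =
      metricDeriv g x v (modelField U x) w +
        modelInner g x (fderiv ℝ (vfieldCoord U x) (extChartAt I x x) v) w := by
    rw [h3.fderiv, vfieldCoord_self, metricCoord_self]
    simp
    ring
  have h5 : flat g U x (christoffel (E := E) (I := I) g x v w) =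
      christoffelLower g x v w (modelField U x) := by
    rw [← inner_christoffel, modelInner_symm]
    rfl
  have h6 : modelInner g x (covDeriv g U x v) w =
      modelInner g x (fderiv ℝ (vfieldCoord U x) (extChartAt I x x) v) w +
        christoffelLower g x v (modelField U x) w := by
    rw [← inner_christoffel, ← add_apply, ← map_add]
    rfl
  rw [h6]
  refine (congrArg₂ (· - ·) h4 h5).trans ?_
  simp only [christoffelLower_apply]
  rw [metricDeriv_symm g x v w (modelField U x)]
  ring

end LeviCivita

/-! ### Flat coordinates on the torus -/

section TorusCoordinates

variable {m : ℕ}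

/-- Two lifts of the same point differ by an integer vector, and a continuous integer-valued
function is locally constant. -/
theorem torus_transition_eventuallyEq (a b : Fin m → ℝ) {x : Fin m → ℝ}
    (hx : x ∈ ((torusChart a).symm.trans (torusChart b)).source) :
    ∃ c : Fin m → ℝ, (fun y => torusChart b ((torusChart a).symm y)) =ᶠ[nhds x]
      fun y => y + c := by
  set f := (torusChart a).symm.trans (torusChart b) with hf
  have hcoe : ∀ y ∈ f.source, ∀ s, ∃ n : ℤ, f y s = y s + n := by
    intro y hy s
    have h1 : y ∈ (torusChart a).symm.source ∧ (torusChart a).symm y ∈ (torusChart b).source := by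
      simpa [hf] using hy
    have h2 : (torusChart b).symm (f y) = (torusChart a).symm y := (torusChart b).left_inv h1.2
    have h3 : ((f y s : ℝ) : UnitAddCircle) = ((y s : ℝ) : UnitAddCircle) := congrFun h2 s
    have h4 : ((f y s - y s : ℝ) : UnitAddCircle) = 0 := by
      rw [AddCircle.coe_sub, h3, sub_self]
    obtain ⟨n, hn⟩ := (AddCircle.coe_eq_zero_iff (1 : ℝ)).1 h4
    exact ⟨n, by simp at hn; linarith⟩
  refine ⟨f x - x, ?_⟩
  have hs : ∀ᶠ y in nhds x, y ∈ f.source := f.open_source.mem_nhds hx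
  have hc : ContinuousAt (fun y => f y - y) x := (f.continuousAt hx).sub continuousAt_id
  filter_upwards [hs, Metric.continuousAt_iff'.1 hc 1 one_pos] with y hy hdy
  change f y = _
  funext s
  obtain ⟨n, hn⟩ := hcoe y hy s
  obtain ⟨k, hk⟩ := hcoe x hx s
  have h5 : dist ((f y - y) s) ((f x - x) s) < 1 := lt_of_le_of_lt (dist_le_pi_dist _ _ s) hdy
  simp only [Pi.sub_apply, hn, hk, add_sub_cancel_left, Real.dist_eq] at h5
  have h6 : |n - k| < 1 := by exact_mod_cast h5
  have h7 : n = k := by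
    have := Int.abs_lt_one_iff.1 h6
    omega
  simp [hn, hk, h7]

/-- Transition maps are local translations, whose derivative is the identity; hence the fields
$\partial/\partial\theta^s$ have constant components in every chart. -/
theorem torus_chartDeriv {θ₀ θ : UnitAddTorus (Fin m)}
    (hθ : θ ∈ (chartAt (Fin m → ℝ) θ₀).source) (v : Fin m → ℝ) :
    chartDeriv 𝓘(ℝ, Fin m → ℝ) θ₀ θ v = v := by
  have : IsManifold 𝓘(ℝ, Fin m → ℝ) 1 (UnitAddTorus (Fin m)) := .of_le (n := ∞) (by simp)
  have h1 : chartDeriv 𝓘(ℝ, Fin m → ℝ) θ₀ θ = fderivWithin ℝ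
      (extChartAt 𝓘(ℝ, Fin m → ℝ) θ₀ ∘ (extChartAt 𝓘(ℝ, Fin m → ℝ) θ).symm)
      (range 𝓘(ℝ, Fin m → ℝ)) (extChartAt 𝓘(ℝ, Fin m → ℝ) θ θ) := by
    rw [← tangentBundleCore_coordChange_achart,
      ← TangentBundle.continuousLinearMapAt_trivializationAt_eq_core hθ,
      TangentBundle.continuousLinearMapAt_trivializationAt hθ]
    rfl
  have hx : torusChart (torusCorner θ) θ ∈
      ((torusChart (torusCorner θ)).symm.trans (torusChart (torusCorner θ₀))).source := by
    have h2 := (torusChart (torusCorner θ)).left_inv (mem_torusChart_source θ)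
    have h3 : θ ∈ (torusChart (torusCorner θ₀)).source := hθ
    rw [OpenPartialHomeomorph.trans_source]
    refine ⟨(torusChart (torusCorner θ)).map_source (mem_torusChart_source θ), ?_⟩
    rw [mem_preimage, h2]
    exact h3
  obtain ⟨c, hc⟩ := torus_transition_eventuallyEq _ _ hx
  have h4 : (extChartAt 𝓘(ℝ, Fin m → ℝ) θ₀ ∘ (extChartAt 𝓘(ℝ, Fin m → ℝ) θ).symm)
      =ᶠ[nhds (extChartAt 𝓘(ℝ, Fin m → ℝ) θ θ)] fun y => y + c := hc
  rw [h1, ModelWithCorners.range_eq_univ, fderivWithin_univ, h4.fderiv_eq, fderiv_add_const]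
  simp

/-- Constant coefficient vector fields on the torus depend smoothly on their coefficients. -/
theorem torus_contMDiff_tangent {E' H' N : Type*} [NormedAddCommGroup E'] [NormedSpace ℝ E']
    [TopologicalSpace H'] {J : ModelWithCorners ℝ E' H'} [TopologicalSpace N] [ChartedSpace H' N]
    {S : Set N} {q : N} {f : N → UnitAddTorus (Fin m)} {a : N → Fin m → ℝ}
    (hf : ContMDiffWithinAt J 𝓘(ℝ, Fin m → ℝ) ∞ f S q)
    (ha : ContMDiffWithinAt J 𝓘(ℝ, Fin m → ℝ) ∞ a S q) :
    ContMDiffWithinAt J (𝓘(ℝ, Fin m → ℝ)).tangent ∞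
      (fun p => (⟨f p, a p⟩ : TangentBundle 𝓘(ℝ, Fin m → ℝ) (UnitAddTorus (Fin m)))) S q := by
  have : IsManifold 𝓘(ℝ, Fin m → ℝ) 1 (UnitAddTorus (Fin m)) := .of_le (n := ∞) (by simp)
  rw [Bundle.contMDiffWithinAt_totalSpace]
  refine ⟨hf, ?_⟩
  have key : ∀ p, f p ∈ (chartAt (Fin m → ℝ) (f q)).source →
      (trivializationAt (Fin m → ℝ) (TangentSpace 𝓘(ℝ, Fin m → ℝ)) (f q)
        (⟨f p, a p⟩ : TangentBundle 𝓘(ℝ, Fin m → ℝ) (UnitAddTorus (Fin m)))).2 = a p := by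
    intro p hp
    have hb : f p ∈ (trivializationAt (Fin m → ℝ) (TangentSpace 𝓘(ℝ, Fin m → ℝ)) (f q)).baseSet := by
      simpa using hp
    have h1 := congrFun ((trivializationAt (Fin m → ℝ) (TangentSpace 𝓘(ℝ, Fin m → ℝ))
      (f q)).coe_linearMapAt_of_mem (R := ℝ) hb) (a p)
    refine h1.symm.trans ?_
    have h2 := TangentBundle.continuousLinearMapAt_trivializationAt (I := 𝓘(ℝ, Fin m → ℝ)) hp
    exact (DFunLike.congr_fun h2 (a p)).trans (torus_chartDeriv hp (a p))
  refine ha.congr_of_eventuallyEq ?_ (key q (mem_chart_source _ _))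
  filter_upwards [hf.continuousWithinAt ((chartAt (Fin m → ℝ) (f q)).open_source.mem_nhds
    (mem_chart_source _ _))] with p hp
  exact key p hp

end TorusCoordinates

/-! ### Coordinates and metric derivatives on the product -/

section ProductCoordinates

open Bundle

set_option linter.unusedSectionVars false
set_option synthInstance.maxHeartbeats 200000

variable {E : Type*} [NormedAddCommGroup E] [NormedSpace ℝ E]
  {H : Type*} [TopologicalSpace H] {I : ModelWithCorners ℝ E H} [I.Boundaryless]
  {M : Type*} [TopologicalSpace M] [ChartedSpace H M] [IsManifold I ∞ M] {m : ℕ}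

theorem hasFDerivAt_chart_transition {x₀ x : M} (hx : x ∈ (chartAt H x₀).source) :
    HasFDerivAt (extChartAt I x₀ ∘ (extChartAt I x).symm) (chartDeriv I x₀ x)
      (extChartAt I x x) := by
  have : IsManifold I 1 M := .of_le (n := ∞) (by simp)
  have h1 : chartDeriv I x₀ x = tangentCoordChange I x x₀ x := by
    rw [tangentCoordChange, ← TangentBundle.continuousLinearMapAt_trivializationAt_eq_core hx,
      TangentBundle.continuousLinearMapAt_trivializationAt hx]
    rfl
  have h2 := hasFDerivWithinAt_tangentCoordChange (I := I) (x := x) (y := x₀) (z := x)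
    ⟨mem_extChartAt_source x, by rwa [extChartAt_source]⟩
  rw [← h1, I.range_eq_univ, hasFDerivWithinAt_univ] at h2
  exact h2

theorem chartDeriv_prod {x₀ x : M} {θ₀ θ : UnitAddTorus (Fin m)}
    (hx : x ∈ (chartAt H x₀).source) (hθ : θ ∈ (chartAt (Fin m → ℝ) θ₀).source)
    (v : E) (η : Fin m → ℝ) :
    chartDeriv (extModel I m) (x₀, θ₀) (x, θ) (v, η) = (chartDeriv I x₀ x v, η) := by
  have hz : (x, θ) ∈ (chartAt (ModelProd H (Fin m → ℝ)) (x₀, θ₀)).source := by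
    rw [prodChartedSpace_chartAt]
    exact ⟨hx, hθ⟩
  have h1 := hasFDerivAt_chart_transition (I := extModel I m) hz
  have h2 : HasFDerivAt (Prod.map (extChartAt I x₀ ∘ (extChartAt I x).symm)
      (extChartAt 𝓘(ℝ, Fin m → ℝ) θ₀ ∘ (extChartAt 𝓘(ℝ, Fin m → ℝ) θ).symm))
      ((chartDeriv I x₀ x).prodMap (chartDeriv 𝓘(ℝ, Fin m → ℝ) θ₀ θ))
      (extChartAt I x x, extChartAt 𝓘(ℝ, Fin m → ℝ) θ θ) :=
    HasFDerivAt.prodMap (extChartAt I x x, extChartAt 𝓘(ℝ, Fin m → ℝ) θ θ)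
      (hasFDerivAt_chart_transition hx) (hasFDerivAt_chart_transition hθ)
  rw [extChartAt_prod, extChartAt_prod] at h1
  have h3 := DFunLike.congr_fun (h1.unique h2) (v, η)
  rw [h3]
  exact Prod.ext rfl (torus_chartDeriv hθ η)

theorem modelFrame_prod {x₀ x : M} {θ₀ θ : UnitAddTorus (Fin m)}
    (hx : x ∈ (chartAt H x₀).source) (hθ : θ ∈ (chartAt (Fin m → ℝ) θ₀).source)
    (v : E) (η : Fin m → ℝ) :
    modelFrame (extModel I m) (x₀, θ₀) (x, θ) (v, η) = (modelFrame I x₀ x v, η) := by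
  have hz : (x, θ) ∈ (chartAt (ModelProd H (Fin m → ℝ)) (x₀, θ₀)).source := by
    rw [prodChartedSpace_chartAt]
    exact ⟨hx, hθ⟩
  rw [← modelFrame_chartDeriv (I := extModel I m) hz (modelFrame I x₀ x v, η),
    chartDeriv_prod hx hθ, chartDeriv_modelFrame hx]

theorem modelInner_ext_apply {g : Metric I M} {w : Fin m → M → ℝ}
    {gt : Metric (extModel I m) (M × UnitAddTorus (Fin m))} (hg : IsExtensionMetric g w gt)
    (z : M × UnitAddTorus (Fin m)) (v v' : E) (η η' : Fin m → ℝ) :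
    modelInner gt z (v, η) (v', η') =
      modelInner g z.1 v v' + ∑ s, w s z.1 * (η s * η' s) :=
  hg.2.2 z.1 z.2 v v' η η'

/-- Evaluate positive definiteness of the extended metric on $\partial/\partial\theta^s$. -/
theorem weight_pos {g : Metric I M} {w : Fin m → M → ℝ}
    {gt : Metric (extModel I m) (M × UnitAddTorus (Fin m))} (hg : IsExtensionMetric g w gt)
    (s : Fin m) (x : M) : 0 < w s x := by
  have h := modelInner_pos gt (x, 0) (0, Pi.single s 1) (by
    intro h
    have := congrFun (congrArg Prod.snd h) s
    simp at this)
  rw [modelInner_ext_apply hg] at h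
  simpa [Pi.single_apply] using h

theorem metricCoord_ext_eventuallyEq {g : Metric I M} {w : Fin m → M → ℝ}
    {gt : Metric (extModel I m) (M × UnitAddTorus (Fin m))} (hg : IsExtensionMetric g w gt)
    (z : M × UnitAddTorus (Fin m)) (v v' : E) (η η' : Fin m → ℝ) :
    (fun y => metricCoord gt z y (v, η) (v', η')) =ᶠ[nhds (extChartAt (extModel I m) z z)]
      fun y => metricCoord g z.1 y.1 v v' +
        ∑ s, w s ((extChartAt I z.1).symm y.1) * (η s * η' s) := by
  filter_upwards [extChartAt_target_mem_nhds (I := extModel I m) z] with y hy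
  rw [metricCoord_apply gt hy]
  rw [extChartAt_prod] at hy ⊢
  have h1 : (extChartAt I z.1).symm y.1 ∈ (chartAt H z.1).source := by
    rw [← extChartAt_source (I := I)]; exact (extChartAt I z.1).map_target hy.1
  have h2 : (extChartAt 𝓘(ℝ, Fin m → ℝ) z.2).symm y.2 ∈ (chartAt (Fin m → ℝ) z.2).source := by
    rw [← extChartAt_source (I := 𝓘(ℝ, Fin m → ℝ))]
    exact (extChartAt 𝓘(ℝ, Fin m → ℝ) z.2).map_target hy.2
  rw [metricCoord_apply g hy.1]
  have h3 := modelFrame_prod (I := I) h1 h2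
  rw [PartialEquiv.prod_symm, PartialEquiv.prod_coe]
  rw [h3, h3, modelInner_ext_apply hg]

theorem hasFDerivAt_comp_chart {f : M → ℝ} {x : M}
    (hf : MDifferentiableAt I 𝓘(ℝ, ℝ) f x) :
    HasFDerivAt (fun y => f ((extChartAt I x).symm y)) (modelForm (differential I f) x)
      (extChartAt I x x) := by
  have h : HasFDerivWithinAt (fun y => f ((extChartAt I x).symm y))
      (modelForm (differential I f) x) (range I) (extChartAt I x x) := hf.hasMFDerivAt.2
  rw [I.range_eq_univ, hasFDerivWithinAt_univ] at h
  exact h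

/-- Near the base point the components of the metric are functions of the coordinates on $M$ alone,
so the torus direction `α` drops out. -/
theorem metricDeriv_ext {g : Metric I M} {w : Fin m → M → ℝ}
    {gt : Metric (extModel I m) (M × UnitAddTorus (Fin m))} (hg : IsExtensionMetric g w gt)
    (z : M × UnitAddTorus (Fin m)) (a v v' : E) (α η η' : Fin m → ℝ) :
    metricDeriv gt z (a, α) (v, η) (v', η') = metricDeriv g z.1 a v v' +
      ∑ s, modelForm (differential I (w s)) z.1 a * (η s * η' s) := by
  have h1 := ((hasFDerivAt_metricCoord gt z).clm_apply (hasFDerivAt_const (v, η) _)).clm_apply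
    (hasFDerivAt_const (v', η') _)
  have hfst : HasFDerivAt Prod.fst (ContinuousLinearMap.fst ℝ E (Fin m → ℝ))
      (extChartAt (extModel I m) z z) := hasFDerivAt_fst
  have h2 := (((hasFDerivAt_metricCoord g z.1).clm_apply
    (hasFDerivAt_const v _)).clm_apply (hasFDerivAt_const v' _)).comp
      (extChartAt (extModel I m) z z) hfst
  have h3 : ∀ s, HasFDerivAt (fun y : E × (Fin m → ℝ) =>
      w s ((extChartAt I z.1).symm y.1) * (η s * η' s)) _ (extChartAt (extModel I m) z z) :=
    fun s => ((hasFDerivAt_comp_chart (((hg.1 s).contMDiffAt (x := z.1)).mdifferentiableAt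
      (by simp))).comp (extChartAt (extModel I m) z z) hfst).mul_const (η s * η' s)
  have h4 := h2.add (HasFDerivAt.fun_sum fun s (_ : s ∈ Finset.univ) => h3 s)
  have h5 := h1.unique (h4.congr_of_eventuallyEq (metricCoord_ext_eventuallyEq hg z v v' η η'))
  have h6 := DFunLike.congr_fun h5 (a, α)
  simpa [mul_comm] using h6

end ProductCoordinates

/-! ### Connection and divergence of the warped product -/

section ExtensionGeometry

open Bundle

set_option linter.unusedSectionVars false
set_option synthInstance.maxHeartbeats 200000

variable {E : Type*} [NormedAddCommGroup E] [NormedSpace ℝ E] [FiniteDimensional ℝ E]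
  {H : Type*} [TopologicalSpace H] {I : ModelWithCorners ℝ E H} [I.Boundaryless]
  {M : Type*} [TopologicalSpace M] [ChartedSpace H M] [IsManifold I ∞ M] {m : ℕ}

/-- The vector field `U + ∑ s, b^s ∂/∂θ^s` on `M × (ℝ/ℤ)^m`. -/
def extField (U : VField I M) (b : Fin m → M → ℝ) :
    VField (extModel I m) (M × UnitAddTorus (Fin m)) :=
  fun z => extVector z.2 (U z.1) (fun s => b s z.1)

theorem modelField_extField (U : VField I M) (b : Fin m → M → ℝ)
    (z : M × UnitAddTorus (Fin m)) :
    modelField (extField U b) z = (modelField U z.1, fun s => b s z.1) := rfl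

/-- By nondegeneracy it suffices to pair both sides with an arbitrary vector, where the left side is
the explicit symbol of the first kind. Positivity of the weights allows the division in the torus
components. -/
theorem christoffel_ext {g : Metric I M} {w : Fin m → M → ℝ}
    {gt : Metric (extModel I m) (M × UnitAddTorus (Fin m))} (hg : IsExtensionMetric g w gt)
    (z : M × UnitAddTorus (Fin m)) (v U : E) (ν A : Fin m → ℝ) :
    christoffel gt z (v, ν) (U, A) =
      (christoffel g z.1 v U -
          ∑ s, (ν s * A s / 2) • modelField (gradient g (w s)) z.1,
        fun s => (modelForm (differential I (w s)) z.1 v * A s +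
          modelForm (differential I (w s)) z.1 U * ν s) / (2 * w s z.1)) := by
  apply modelInner_ext gt z
  rintro ⟨c, κ⟩
  rw [inner_christoffel, christoffelLower_apply, metricDeriv_ext hg, metricDeriv_ext hg,
    metricDeriv_ext hg, modelInner_ext_apply hg, map_sub, map_sum, sub_apply,
    inner_christoffel, christoffelLower_apply, sum_apply]
  have h1 : ∀ s, modelInner g z.1 ((ν s * A s / 2) • modelField (gradient g (w s)) z.1) c =
      ν s * A s / 2 * modelForm (differential I (w s)) z.1 c := by
    intro s
    rw [map_smul, smul_apply, smul_eq_mul, ← inner_gradient]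
    rfl
  have h2 : ∀ s, w s z.1 * ((modelForm (differential I (w s)) z.1 v * A s +
      modelForm (differential I (w s)) z.1 U * ν s) / (2 * w s z.1) * κ s) =
      (modelForm (differential I (w s)) z.1 v * (A s * κ s) +
      modelForm (differential I (w s)) z.1 U * (ν s * κ s)) / 2 := by
    intro s
    have := (weight_pos hg s z.1).ne'
    field_simp
  simp only [h1, h2]
  have h3 : ∑ s, ν s * A s / 2 * modelForm (differential I (w s)) z.1 c =
      (∑ s, modelForm (differential I (w s)) z.1 c * (ν s * A s)) / 2 := by
    rw [Finset.sum_div]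
    exact Finset.sum_congr rfl fun s _ => by ring
  rw [h3, ← Finset.sum_div, Finset.sum_add_distrib]
  ring

theorem vfieldCoord_ext_eventuallyEq (U : VField I M) (b : Fin m → M → ℝ)
    (z : M × UnitAddTorus (Fin m)) :
    vfieldCoord (extField U b) z =ᶠ[nhds (extChartAt (extModel I m) z z)]
      fun y => (vfieldCoord U z.1 y.1, fun s => b s ((extChartAt I z.1).symm y.1)) := by
  filter_upwards [extChartAt_target_mem_nhds (I := extModel I m) z] with y hy
  rw [vfieldCoord_eq, vfieldCoord_eq, modelField_extField]
  rw [extChartAt_prod] at hy ⊢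
  have h1 : (extChartAt I z.1).symm y.1 ∈ (chartAt H z.1).source := by
    rw [← extChartAt_source (I := I)]; exact (extChartAt I z.1).map_target hy.1
  have h2 : (extChartAt 𝓘(ℝ, Fin m → ℝ) z.2).symm y.2 ∈ (chartAt (Fin m → ℝ) z.2).source := by
    rw [← extChartAt_source (I := 𝓘(ℝ, Fin m → ℝ))]
    exact (extChartAt 𝓘(ℝ, Fin m → ℝ) z.2).map_target hy.2
  exact chartDeriv_prod (I := I) h1 h2 _ _

theorem hasFDerivAt_vfieldCoord_ext {U : VField I M} {b : Fin m → M → ℝ}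
    {z : M × UnitAddTorus (Fin m)}
    (hU : ContMDiffAt I I.tangent ∞ (fun p => (⟨p, U p⟩ : TangentBundle I M)) z.1)
    (hb : ∀ s, ContMDiffAt I 𝓘(ℝ, ℝ) ∞ (b s) z.1) :
    HasFDerivAt (vfieldCoord (extField U b) z)
      (((fderiv ℝ (vfieldCoord U z.1) (extChartAt I z.1 z.1)).prod
        (ContinuousLinearMap.pi fun s => modelForm (differential I (b s)) z.1)).comp
          (ContinuousLinearMap.fst ℝ E (Fin m → ℝ))) (extChartAt (extModel I m) z z) := by
  have h1 : HasFDerivAt (fun y => (vfieldCoord U z.1 y, fun s => b s ((extChartAt I z.1).symm y)))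
      ((fderiv ℝ (vfieldCoord U z.1) (extChartAt I z.1 z.1)).prod
        (ContinuousLinearMap.pi fun s => modelForm (differential I (b s)) z.1))
      (extChartAt I z.1 z.1) := by
    refine HasFDerivAt.prodMk
      ((contDiffAt_vfieldCoord hU).differentiableAt (by simp)).hasFDerivAt ?_
    rw [hasFDerivAt_pi]
    exact fun s => hasFDerivAt_comp_chart ((hb s).mdifferentiableAt (by simp))
  have hfst : HasFDerivAt Prod.fst (ContinuousLinearMap.fst ℝ E (Fin m → ℝ))
      (extChartAt (extModel I m) z z) := hasFDerivAt_fst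
  have h2 := HasFDerivAt.comp (extChartAt (extModel I m) z z)
    (f := (Prod.fst : E × (Fin m → ℝ) → E)) h1 hfst
  exact h2.congr_of_eventuallyEq
    (vfieldCoord_ext_eventuallyEq U b z)

/-- The covariant derivative of a vector field, read in the model space. -/
def modelCov (g : Metric I M) (U : VField I M) (x : M) : E →ₗ[ℝ] E := covDeriv g U x

theorem modelCov_apply (g : Metric I M) (U : VField I M) (x : M) (v : E) :
    modelCov g U x v = fderiv ℝ (vfieldCoord U x) (extChartAt I x x) v +
      christoffel g x v (modelField U x) := rfl

theorem modelCov_ext {g : Metric I M} {w : Fin m → M → ℝ}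
    {gt : Metric (extModel I m) (M × UnitAddTorus (Fin m))} (hg : IsExtensionMetric g w gt)
    {U : VField I M} {b : Fin m → M → ℝ} {z : M × UnitAddTorus (Fin m)}
    (hU : ContMDiffAt I I.tangent ∞ (fun p => (⟨p, U p⟩ : TangentBundle I M)) z.1)
    (hb : ∀ s, ContMDiffAt I 𝓘(ℝ, ℝ) ∞ (b s) z.1) (v : E) (ν : Fin m → ℝ) :
    modelCov gt (extField U b) z (v, ν) =
      (modelCov g U z.1 v - ∑ s, (ν s * b s z.1 / 2) • modelField (gradient g (w s)) z.1,
        fun s => modelForm (differential I (b s)) z.1 v +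
          (modelForm (differential I (w s)) z.1 v * b s z.1 +
            modelForm (differential I (w s)) z.1 (modelField U z.1) * ν s) / (2 * w s z.1)) := by
  rw [modelCov_apply, (hasFDerivAt_vfieldCoord_ext hU hb).fderiv, modelField_extField,
    christoffel_ext hg, modelCov_apply]
  refine Prod.ext ?_ rfl
  exact (add_sub_assoc _ _ _).symm

theorem divergence_eq_trace (g : Metric I M) (U : VField I M) (x : M) :
    divergence g U x = LinearMap.trace ℝ E (modelCov g U x) := rfl

/-- Split `L` over the two inclusions and use cyclicity of the trace on each summand. -/
theorem trace_prod {V W : Type*} [AddCommGroup V] [Module ℝ V] [FiniteDimensional ℝ V]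
    [AddCommGroup W] [Module ℝ W] [FiniteDimensional ℝ W] (L : V × W →ₗ[ℝ] V × W) :
    LinearMap.trace ℝ (V × W) L =
      LinearMap.trace ℝ V (LinearMap.fst ℝ V W ∘ₗ L ∘ₗ LinearMap.inl ℝ V W) +
        LinearMap.trace ℝ W (LinearMap.snd ℝ V W ∘ₗ L ∘ₗ LinearMap.inr ℝ V W) := by
  have h : L = (L ∘ₗ LinearMap.inl ℝ V W) ∘ₗ LinearMap.fst ℝ V W +
      (L ∘ₗ LinearMap.inr ℝ V W) ∘ₗ LinearMap.snd ℝ V W := by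
    refine LinearMap.ext fun x => ?_
    simp [← map_add]
  conv_lhs => rw [h]
  rw [map_add, LinearMap.trace_comp_comm' (L ∘ₗ LinearMap.inl ℝ V W) (LinearMap.fst ℝ V W),
    LinearMap.trace_comp_comm' (L ∘ₗ LinearMap.inr ℝ V W) (LinearMap.snd ℝ V W)]

theorem trace_diagonal (c : Fin m → ℝ) (L : (Fin m → ℝ) →ₗ[ℝ] Fin m → ℝ)
    (hL : ∀ ν s, L ν s = c s * ν s) : LinearMap.trace ℝ (Fin m → ℝ) L = ∑ s, c s := by
  rw [LinearMap.trace_eq_matrix_trace ℝ (Pi.basisFun ℝ (Fin m)), Matrix.trace]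
  refine Finset.sum_congr rfl fun s _ => ?_
  simp [hL]

/-- Only the diagonal blocks of the covariant derivative count. The swirl enters them nowhere: in
the block of $M$ its term carries the factor $\nu=0$, and in the torus block its terms carry $v=0$.
-/
theorem divergence_ext_eq_sum {g : Metric I M} {w : Fin m → M → ℝ}
    {gt : Metric (extModel I m) (M × UnitAddTorus (Fin m))} (hg : IsExtensionMetric g w gt)
    {U : VField I M} {b : Fin m → M → ℝ} {z : M × UnitAddTorus (Fin m)}
    (hU : ContMDiffAt I I.tangent ∞ (fun p => (⟨p, U p⟩ : TangentBundle I M)) z.1)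
    (hb : ∀ s, ContMDiffAt I 𝓘(ℝ, ℝ) ∞ (b s) z.1) :
    divergence gt (extField U b) z = divergence g U z.1 +
      ∑ s, modelForm (differential I (w s)) z.1 (modelField U z.1) / (2 * w s z.1) := by
  rw [divergence_eq_trace, trace_prod, divergence_eq_trace]
  congr 1
  · congr 1
    ext v
    change (modelCov gt (extField U b) z (v, 0)).1 = _
    rw [modelCov_ext hg hU hb]
    simp
  · apply trace_diagonal
    intro ν s
    change (modelCov gt (extField U b) z (0, ν)).2 s = _
    rw [modelCov_ext hg hU hb]
    simp
    ring

/-- Differentiate $\log\prod_s w_s=0$. -/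
theorem sum_dlog_weight {g : Metric I M} {w : Fin m → M → ℝ}
    {gt : Metric (extModel I m) (M × UnitAddTorus (Fin m))} (hg : IsExtensionMetric g w gt)
    (x : M) (v : E) : ∑ s, modelForm (differential I (w s)) x v / w s x = 0 := by
  have h1 := HasFDerivAt.fun_sum (u := Finset.univ) (fun s _ =>
    (hasFDerivAt_comp_chart (((hg.1 s).contMDiffAt (x := x)).mdifferentiableAt (by simp))).log
      (by rw [extChartAt_to_inv]; exact (weight_pos hg s x).ne'))
  have h2 : (fun y => ∑ s, Real.log (w s ((extChartAt I x).symm y))) = fun _ => 0 := by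
    funext y
    rw [← Real.log_prod fun s _ => (weight_pos hg s _).ne', hg.2.1, Real.log_one]
  rw [h2] at h1
  have h3 := DFunLike.congr_fun (h1.unique (hasFDerivAt_const (0 : ℝ) _)) v
  simpa only [sum_apply, smul_apply, smul_eq_mul, extChartAt_to_inv, inv_mul_eq_div,
    zero_apply] using h3

theorem divergence_ext {g : Metric I M} {w : Fin m → M → ℝ}
    {gt : Metric (extModel I m) (M × UnitAddTorus (Fin m))} (hg : IsExtensionMetric g w gt)
    {U : VField I M} {b : Fin m → M → ℝ} {z : M × UnitAddTorus (Fin m)}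
    (hU : ContMDiffAt I I.tangent ∞ (fun p => (⟨p, U p⟩ : TangentBundle I M)) z.1)
    (hb : ∀ s, ContMDiffAt I 𝓘(ℝ, ℝ) ∞ (b s) z.1) :
    divergence gt (extField U b) z = divergence g U z.1 := by
  have h := sum_dlog_weight hg z.1 (modelField U z.1)
  have h2 : ∀ s, modelForm (differential I (w s)) z.1 (modelField U z.1) / (2 * w s z.1) =
      modelForm (differential I (w s)) z.1 (modelField U z.1) / w s z.1 / 2 := fun s => by
    rw [div_div, mul_comm]
  rw [divergence_ext_eq_sum hg hU hb, Finset.sum_congr rfl fun s _ => h2 s, ← Finset.sum_div, h]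
  simp

end ExtensionGeometry

/-! ### Time derivatives and the Euler equations of an extension -/

section TimeDependence

open Bundle

set_option linter.unusedSectionVars false
set_option synthInstance.maxHeartbeats 200000

variable {E : Type*} [NormedAddCommGroup E] [NormedSpace ℝ E] [FiniteDimensional ℝ E]
  {H : Type*} [TopologicalSpace H] {I : ModelWithCorners ℝ E H} [I.Boundaryless]
  {M : Type*} [TopologicalSpace M] [ChartedSpace H M] [IsManifold I ∞ M] {m : ℕ} {T : ℝ}

theorem contMDiff_timeSlice (t : ℝ) : ContMDiff I (𝓘(ℝ, ℝ).prod I) ∞ (fun x : M => (t, x)) :=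
  contMDiff_const.prodMk contMDiff_id

theorem contMDiff_pointSlice (x : M) :
    ContMDiff 𝓘(ℝ, ℝ) (𝓘(ℝ, ℝ).prod I) ∞ (fun t : ℝ => (t, x)) :=
  contMDiff_id.prodMk contMDiff_const

theorem IsFlow.contMDiff {u : ℝ → VField I M} (hu : IsFlow T u) {t : ℝ} (ht : t ∈ Icc 0 T) :
    ContMDiff I I.tangent ∞ (fun p => (⟨p, u t p⟩ : TangentBundle I M)) := by
  rw [← contMDiffOn_univ]
  exact hu.comp (contMDiff_timeSlice t).contMDiffOn fun x _ => ⟨ht, mem_univ x⟩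

theorem SmoothScalar.contMDiff {f : ℝ → M → ℝ} (hf : SmoothScalar I T f) {t : ℝ}
    (ht : t ∈ Icc 0 T) : ContMDiff I 𝓘(ℝ, ℝ) ∞ (f t) := by
  rw [← contMDiffOn_univ]
  exact ContMDiffOn.comp (g := fun q : ℝ × M => f q.1 q.2) hf
    (contMDiff_timeSlice t).contMDiffOn fun x _ => ⟨ht, mem_univ x⟩

theorem SmoothScalar.hasDerivWithinAt {f : ℝ → M → ℝ} (hf : SmoothScalar I T f) {t : ℝ}
    (ht : t ∈ Icc 0 T) (x : M) :
    HasDerivWithinAt (fun τ => f τ x) (derivWithin (fun τ => f τ x) (Icc 0 T) t) (Icc 0 T) t := by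
  have h : ContMDiffOn 𝓘(ℝ, ℝ) 𝓘(ℝ, ℝ) ∞ (fun τ => f τ x) (Icc 0 T) :=
    ContMDiffOn.comp hf (contMDiff_pointSlice x).contMDiffOn fun t ht => ⟨ht, mem_univ x⟩
  exact ((contMDiffOn_iff_contDiffOn.1 h).differentiableOn (by simp) t ht).hasDerivWithinAt

/-- The time derivative of a vector field, read in the model space. -/
def modelTimeDeriv (T : ℝ) (u : ℝ → VField I M) (t : ℝ) (x : M) : E := timeDeriv T u t x

/-- The trivialization centred at `x` is the identity on the fibre over `x`, so a smooth curve in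
that fibre is a smooth curve in the model space. -/
theorem IsFlow.hasDerivWithinAt {u : ℝ → VField I M} (hu : IsFlow T u) {t : ℝ}
    (ht : t ∈ Icc 0 T) (x : M) :
    HasDerivWithinAt (fun τ => modelField (u τ) x) (modelTimeDeriv T u t x) (Icc 0 T) t := by
  have h : ContMDiffOn 𝓘(ℝ, ℝ) I.tangent ∞ (fun τ => (⟨x, u τ x⟩ : TangentBundle I M)) (Icc 0 T) :=
    ContMDiffOn.comp (g := fun q : ℝ × M => (⟨q.2, u q.1 q.2⟩ : TangentBundle I M)) hu
      (contMDiff_pointSlice x).contMDiffOn fun t ht => ⟨ht, mem_univ x⟩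
  have h1 := (contMDiffWithinAt_totalSpace.1 (h t ht)).2
  have h2 : ∀ τ, (trivializationAt E (TangentSpace I) x (⟨x, u τ x⟩ : TangentBundle I M)).2 =
      modelField (u τ) x := by
    intro τ
    have : IsManifold I 1 M := .of_le (n := ∞) (by simp)
    have hb : x ∈ (trivializationAt E (TangentSpace I) x).baseSet := by simp
    have h3 := congrFun ((trivializationAt E (TangentSpace I) x).coe_linearMapAt_of_mem (R := ℝ) hb)
      (u τ x)
    have h4 := TangentBundle.continuousLinearMapAt_trivializationAt (I := I) (mem_chart_source H x)
    exact h3.symm.trans ((DFunLike.congr_fun h4 (u τ x)).trans (chartDeriv_self x _))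
  simp only [h2] at h1
  exact ((contMDiffWithinAt_iff_contDiffWithinAt.1 h1).differentiableWithinAt
    (by simp)).hasDerivWithinAt

/-- The metric is constant in time, and $T>0$ makes the one-sided derivatives on the interval
unique. -/
theorem timeDerivForm_flat (hT : 0 < T) (g : Metric I M) {u : ℝ → VField I M} (hu : IsFlow T u)
    {t : ℝ} (ht : t ∈ Icc 0 T) (x : M) (c : E) :
    timeDerivForm T (fun τ => flat g (u τ)) t x c =
      modelInner g x (modelTimeDeriv T u t x) c := by
  have h := (modelInner g x).hasFDerivAt.comp_hasDerivWithinAt t (hu.hasDerivWithinAt ht x)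
  have h2 := h.derivWithin (uniqueDiffOn_Icc hT t ht)
  exact DFunLike.congr_fun h2 c

theorem extendedFlow_apply (u : ℝ → VField I M) (a : Fin m → ℝ → M → ℝ) (t : ℝ) :
    extendedFlow u a t = extField (u t) (fun s => a s t) := rfl

theorem modelTimeDeriv_ext (hT : 0 < T) {u : ℝ → VField I M} (hu : IsFlow T u)
    {a : Fin m → ℝ → M → ℝ} (ha : ∀ s, SmoothScalar I T (a s)) {t : ℝ} (ht : t ∈ Icc 0 T)
    (z : M × UnitAddTorus (Fin m)) :
    modelTimeDeriv T (extendedFlow u a) t z = (modelTimeDeriv T u t z.1,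
      fun s => derivWithin (fun τ => a s τ z.1) (Icc 0 T) t) := by
  have h := (hu.hasDerivWithinAt ht z.1).prodMk
    (hasDerivWithinAt_pi.2 fun s => (ha s).hasDerivWithinAt ht z.1)
  exact h.derivWithin (uniqueDiffOn_Icc hT t ht)

/-- The tangent bundle of the product is the product of the tangent bundles; each factor is smooth
separately. -/
theorem IsFlow.extendedFlow {u : ℝ → VField I M} (hu : IsFlow T u)
    {a : Fin m → ℝ → M → ℝ} (ha : ∀ s, SmoothScalar I T (a s)) :
    IsFlow T (extendedFlow u a) := by
  have hI : IsManifold I 1 M := .of_le (n := ∞) (by simp)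
  have hJ : IsManifold 𝓘(ℝ, Fin m → ℝ) 1 (UnitAddTorus (Fin m)) := .of_le (n := ∞) (by simp)
  have hp : ContMDiff (𝓘(ℝ, ℝ).prod (extModel I m)) (𝓘(ℝ, ℝ).prod I) ∞
      (fun q : ℝ × M × UnitAddTorus (Fin m) => (q.1, q.2.1)) :=
    contMDiff_fst.prodMk (contMDiff_fst.comp contMDiff_snd)
  have hm : MapsTo (fun q : ℝ × M × UnitAddTorus (Fin m) => (q.1, q.2.1)) (Icc 0 T ×ˢ univ)
      (Icc 0 T ×ˢ univ) := fun q hq => ⟨hq.1, mem_univ _⟩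
  have h1 := ContMDiffOn.comp hu hp.contMDiffOn hm
  have h2 : ContMDiffOn (𝓘(ℝ, ℝ).prod (extModel I m)) (𝓘(ℝ, Fin m → ℝ)).tangent ∞
      (fun q : ℝ × M × UnitAddTorus (Fin m) => (⟨q.2.2, fun s => a s q.1 q.2.1⟩ :
        TangentBundle 𝓘(ℝ, Fin m → ℝ) (UnitAddTorus (Fin m)))) (Icc 0 T ×ˢ univ) := by
    intro q hq
    refine torus_contMDiff_tangent ?_ ?_
    · exact (contMDiff_snd.comp contMDiff_snd).contMDiffAt.contMDiffWithinAt
    · rw [contMDiffWithinAt_pi_space]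
      exact fun s => ContMDiffOn.comp (ha s) hp.contMDiffOn hm q hq
  exact (contMDiff_equivTangentBundleProd_symm (n := ∞)).comp_contMDiffOn (h1.prodMk h2)

/-- The components of the Euler equations on `M × (ℝ/ℤ)^m` with lowered indices. -/
theorem inner_euler_ext (hT : 0 < T) {g : Metric I M} {w : Fin m → M → ℝ}
    {gt : Metric (extModel I m) (M × UnitAddTorus (Fin m))} (hg : IsExtensionMetric g w gt)
    {u : ℝ → VField I M} (hu : IsFlow T u) {a : Fin m → ℝ → M → ℝ}
    (ha : ∀ s, SmoothScalar I T (a s)) {t : ℝ} (ht : t ∈ Icc 0 T)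
    (z : M × UnitAddTorus (Fin m)) (c : E) (κ : Fin m → ℝ) :
    modelInner gt z (modelTimeDeriv T (extendedFlow u a) t z +
        modelCov gt (extendedFlow u a t) z (modelField (extendedFlow u a t) z)) (c, κ) =
      timeDerivForm T (fun τ => flat g (u τ)) t z.1 c +
        covDerivForm g (flat g (u t)) z.1 (u t z.1) c -
        ∑ s, a s t z.1 ^ 2 / 2 * modelForm (differential I (w s)) z.1 c +
        ∑ s, (w s z.1 * (derivWithin (fun τ => a s τ z.1) (Icc 0 T) t +
          modelForm (differential I (a s t)) z.1 (modelField (u t) z.1)) +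
          modelForm (differential I (w s)) z.1 (modelField (u t) z.1) * a s t z.1) * κ s := by
  have h0 : covDerivForm g (flat g (u t)) z.1 (u t z.1) c =
      modelInner g z.1 (modelCov g (u t) z.1 (modelField (u t) z.1)) c :=
    covDerivForm_flat g (hu.contMDiff ht).contMDiffAt _ _
  rw [timeDerivForm_flat hT g hu ht, h0, modelTimeDeriv_ext hT hu ha ht, extendedFlow_apply,
    modelField_extField, modelCov_ext hg (hu.contMDiff ht).contMDiffAt
      fun s => ((ha s).contMDiff ht).contMDiffAt, Prod.mk_add_mk, modelInner_ext_apply hg,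
    map_add, map_sub, map_sum, add_apply, sub_apply, sum_apply, add_sub_assoc']
  congr 1
  · congr 1
    refine Finset.sum_congr rfl fun s _ => ?_
    rw [map_smul, smul_apply, smul_eq_mul, ← inner_gradient, pow_two]
    rfl
  -- The direction and the differentiated field agree, so the two halves of the mixed Christoffel
  -- symbol coincide and add up to $a^s\,dw_s(u)/w_s$; lowering the index multiplies by $w_s$.
  · refine Finset.sum_congr rfl fun s _ => ?_
    have := (weight_pos hg s z.1).ne'
    simp only [Pi.add_apply]
    field_simp
    ring

end TimeDependence

/-! ### Differentials of scalar functions -/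

section Differentials

open Bundle

set_option linter.unusedSectionVars false
set_option synthInstance.maxHeartbeats 200000

variable {E : Type*} [NormedAddCommGroup E] [NormedSpace ℝ E] [FiniteDimensional ℝ E]
  {H : Type*} [TopologicalSpace H] {I : ModelWithCorners ℝ E H} [I.Boundaryless]
  {M : Type*} [TopologicalSpace M] [ChartedSpace H M] [IsManifold I ∞ M] {m : ℕ} {T : ℝ}

theorem differential_eq {f : M → ℝ} {x : M} (hf : MDifferentiableAt I 𝓘(ℝ, ℝ) f x)
    {L : E →L[ℝ] ℝ}
    (h : HasFDerivAt (fun y => f ((extChartAt I x).symm y)) L (extChartAt I x x)) :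
    modelForm (differential I f) x = L :=
  (hasFDerivAt_comp_chart hf).unique h

/-- The chain rule for differentials of scalar functions. -/
theorem differential_comp {f : M → ℝ} {x : M} (hf : MDifferentiableAt I 𝓘(ℝ, ℝ) f x)
    {φ : ℝ → ℝ} {φ' : ℝ} (hφ : HasDerivAt φ φ' (f x)) (v : E) :
    modelForm (differential I (fun p => φ (f p))) x v =
      φ' * modelForm (differential I f) x v := by
  have hd : MDifferentiableAt I 𝓘(ℝ, ℝ) (fun p => φ (f p)) x :=
    MDifferentiableAt.comp (I' := 𝓘(ℝ, ℝ)) (g := φ) x hφ.differentiableAt.mdifferentiableAt hf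
  have hφ' : HasDerivAt φ φ' (f ((extChartAt I x).symm (extChartAt I x x))) := by
    rwa [extChartAt_to_inv]
  have h1 := hφ'.comp_hasFDerivAt (extChartAt I x x) (hasFDerivAt_comp_chart hf)
  rw [differential_eq hd h1]
  rfl

theorem differential_mul {f h : M → ℝ} {x : M} (hf : MDifferentiableAt I 𝓘(ℝ, ℝ) f x)
    (hh : MDifferentiableAt I 𝓘(ℝ, ℝ) h x) (v : E) :
    modelForm (differential I (fun p => f p * h p)) x v =
      f x * modelForm (differential I h) x v + h x * modelForm (differential I f) x v := by
  have hd : MDifferentiableAt I 𝓘(ℝ, ℝ) (fun p => f p * h p) x := hf.mul hh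
  have h1 := (hasFDerivAt_comp_chart hf).mul (hasFDerivAt_comp_chart hh)
  rw [differential_eq hd h1, extChartAt_to_inv]
  rfl

theorem differential_add {f h : M → ℝ} {x : M} (hf : MDifferentiableAt I 𝓘(ℝ, ℝ) f x)
    (hh : MDifferentiableAt I 𝓘(ℝ, ℝ) h x) (v : E) :
    modelForm (differential I (fun p => f p + h p)) x v =
      modelForm (differential I f) x v + modelForm (differential I h) x v := by
  have hd : MDifferentiableAt I 𝓘(ℝ, ℝ) (fun p => f p + h p) x := hf.add hh
  rw [differential_eq hd ((hasFDerivAt_comp_chart hf).add (hasFDerivAt_comp_chart hh))]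
  rfl

theorem differential_prod_left {f : M × UnitAddTorus (Fin m) → ℝ} {x : M}
    {θ : UnitAddTorus (Fin m)} (hf : MDifferentiableAt (extModel I m) 𝓘(ℝ, ℝ) f (x, θ)) (c : E) :
    modelForm (differential (extModel I m) f) (x, θ) (c, 0) =
      modelForm (differential I (fun p => f (p, θ))) x c := by
  have hd : MDifferentiableAt I 𝓘(ℝ, ℝ) (fun p => f (p, θ)) x :=
    MDifferentiableAt.comp (I' := extModel I m) (g := f) (f := fun p => (p, θ)) x hf
      (mdifferentiableAt_id.prodMk mdifferentiableAt_const)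
  have h1 := hasFDerivAt_comp_chart hf
  rw [extChartAt_prod] at h1
  have h2 : HasFDerivAt (fun y : E => (y, extChartAt 𝓘(ℝ, Fin m → ℝ) θ θ))
      (ContinuousLinearMap.inl ℝ E (Fin m → ℝ)) (extChartAt I x x) := hasFDerivAt_prodMk_left _ _
  have h3 := HasFDerivAt.comp (extChartAt I x x) h1 h2
  have h4 : (fun y => f ((extChartAt I x).symm y, θ)) = (fun y => f
      (((extChartAt I x).prod (extChartAt 𝓘(ℝ, Fin m → ℝ) θ)).symm y)) ∘
      (fun y : E => (y, extChartAt 𝓘(ℝ, Fin m → ℝ) θ θ)) := by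
    funext y
    change _ = f ((extChartAt I x).symm y,
      (extChartAt 𝓘(ℝ, Fin m → ℝ) θ).symm (extChartAt 𝓘(ℝ, Fin m → ℝ) θ θ))
    rw [extChartAt_to_inv]
  rw [← h4] at h3
  rw [differential_eq hd h3]
  rfl

theorem differential_comp_fst {f : M → ℝ} {z : M × UnitAddTorus (Fin m)}
    (hf : MDifferentiableAt I 𝓘(ℝ, ℝ) f z.1) (c : E) (κ : Fin m → ℝ) :
    modelForm (differential (extModel I m) (fun p => f p.1)) z (c, κ) =
      modelForm (differential I f) z.1 c := by
  have hd : MDifferentiableAt (extModel I m) 𝓘(ℝ, ℝ) (fun p => f p.1) z :=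
    MDifferentiableAt.comp (I' := I) (g := f) z hf mdifferentiableAt_fst
  have hfst : HasFDerivAt Prod.fst (ContinuousLinearMap.fst ℝ E (Fin m → ℝ))
      (extChartAt (extModel I m) z z) := hasFDerivAt_fst
  have h1 := HasFDerivAt.comp (extChartAt (extModel I m) z z)
    (f := (Prod.fst : E × (Fin m → ℝ) → E)) (hasFDerivAt_comp_chart hf) hfst
  rw [differential_eq hd (L := (modelForm (differential I f) z.1).comp
    (ContinuousLinearMap.fst ℝ E (Fin m → ℝ))) (by rw [extChartAt_prod] at h1 ⊢; exact h1)]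
  rfl

/-- A maximum of `f` over the compact torus above `x` is a critical point in the torus directions.
-/
theorem exists_differential_torus_eq_zero {f : M × UnitAddTorus (Fin m) → ℝ}
    (hf : ContMDiff (extModel I m) 𝓘(ℝ, ℝ) ∞ f) (x : M) :
    ∃ θ : UnitAddTorus (Fin m), ∀ κ : Fin m → ℝ,
      modelForm (differential (extModel I m) f) (x, θ) (0, κ) = 0 := by
  have hc : Continuous fun θ : UnitAddTorus (Fin m) => f (x, θ) :=
    hf.continuous.comp (Continuous.prodMk_right x)
  obtain ⟨θ, -, hθ⟩ := isCompact_univ.exists_isMaxOn univ_nonempty hc.continuousOn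
  refine ⟨θ, fun κ => ?_⟩
  have h1 := hasFDerivAt_comp_chart (hf.contMDiffAt.mdifferentiableAt (x := (x, θ)) (by simp))
  rw [extChartAt_prod] at h1
  have h2 : HasFDerivAt (fun y : Fin m → ℝ => (extChartAt I x x, y))
      (ContinuousLinearMap.inr ℝ E (Fin m → ℝ)) (extChartAt 𝓘(ℝ, Fin m → ℝ) θ θ) :=
    hasFDerivAt_prodMk_right _ _
  have h3 := HasFDerivAt.comp (extChartAt 𝓘(ℝ, Fin m → ℝ) θ θ) h1 h2
  have hmax : IsLocalMax ((fun y => f (((extChartAt I x).prod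
      (extChartAt 𝓘(ℝ, Fin m → ℝ) θ)).symm y)) ∘ (fun y : Fin m → ℝ => (extChartAt I x x, y)))
      (extChartAt 𝓘(ℝ, Fin m → ℝ) θ θ) := by
    -- The maximum is global over the fibre and the inverse chart always takes values in the torus,
    -- so no restriction to the chart target is needed.
    refine Filter.Eventually.of_forall fun y => ?_
    change f ((extChartAt I x).symm (extChartAt I x x), (extChartAt 𝓘(ℝ, Fin m → ℝ) θ).symm y) ≤
      f ((extChartAt I x).symm (extChartAt I x x),
        (extChartAt 𝓘(ℝ, Fin m → ℝ) θ).symm (extChartAt 𝓘(ℝ, Fin m → ℝ) θ θ))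
    rw [extChartAt_to_inv, extChartAt_to_inv]
    exact hθ (mem_univ _)
  exact DFunLike.congr_fun (hmax.hasFDerivAt_eq_zero h3) κ

theorem eq_neg_gradient_iff (g : Metric I M) (f : M → ℝ) (x : M) (X : E) :
    X = -modelField (gradient g f) x ↔
      ∀ c, modelInner g x X c = -modelForm (differential I f) x c := by
  rw [← (modelInner_injective g x).eq_iff, map_neg, ContinuousLinearMap.ext_iff]
  refine forall_congr' fun c => ?_
  rw [← inner_gradient, neg_apply]
  rfl

/-- Together with `hasDerivWithinAt_swirl` this shows that $(wa)^2/2$ is transported as soon as $wa$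
is. -/
theorem differential_swirl {w a ρ : M → ℝ} {x : M} (v : E)
    (hw : MDifferentiableAt I 𝓘(ℝ, ℝ) w x) (ha : MDifferentiableAt I 𝓘(ℝ, ℝ) a x)
    (hρ : ρ = fun p => (w p * a p) ^ 2 / 2) :
    modelForm (differential I ρ) x v = w x * a x * (w x * modelForm (differential I a) x v +
      a x * modelForm (differential I w) x v) := by
  have h := ((hasDerivAt_id (w x * a x)).pow 2).div_const 2
  rw [hρ, ← differential_mul hw ha]
  refine (differential_comp (f := fun p => w p * a p) (φ := fun r => r ^ 2 / 2) (hw.mul ha)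
    h v).trans ?_
  simp

end Differentials

/-! ### From an extended Euler flow to the Boussinesq system -/

section EulerToBoussinesq

open Bundle

set_option linter.unusedSectionVars false
set_option synthInstance.maxHeartbeats 200000

variable {E : Type*} [NormedAddCommGroup E] [NormedSpace ℝ E] [FiniteDimensional ℝ E]
  {H : Type*} [TopologicalSpace H] {I : ModelWithCorners ℝ E H} [I.Boundaryless]
  {M : Type*} [TopologicalSpace M] [ChartedSpace H M] [IsManifold I ∞ M] {m : ℕ} {T : ℝ}

theorem smoothScalar_const {f : M → ℝ} (hf : ContMDiff I 𝓘(ℝ, ℝ) ∞ f) :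
    SmoothScalar I T (fun _ => f) :=
  (hf.comp contMDiff_snd).contMDiffOn

theorem SmoothScalar.mul {f h : ℝ → M → ℝ} (hf : SmoothScalar I T f) (hh : SmoothScalar I T h) :
    SmoothScalar I T (fun t x => f t x * h t x) :=
  ContMDiffOn.mul (f := fun q : ℝ × M => f q.1 q.2) (g := fun q : ℝ × M => h q.1 q.2) hf hh

theorem SmoothScalar.add {f h : ℝ → M → ℝ} (hf : SmoothScalar I T f) (hh : SmoothScalar I T h) :
    SmoothScalar I T (fun t x => f t x + h t x) :=
  ContMDiffOn.add (f := fun q : ℝ × M => f q.1 q.2) (g := fun q : ℝ × M => h q.1 q.2) hf hh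

theorem SmoothScalar.comp {f : ℝ → M → ℝ} (hf : SmoothScalar I T f) {φ : ℝ → ℝ}
    (hφ : ∀ t ∈ Icc 0 T, ∀ x, ContDiffAt ℝ ∞ φ (f t x)) :
    SmoothScalar I T (fun t x => φ (f t x)) := fun q hq =>
  (hφ q.1 hq.1 q.2).comp_contMDiffWithinAt (f := fun q : ℝ × M => f q.1 q.2) (hf q hq)

/-- A function on `M × (ℝ/ℤ)^m` whose differential along the torus has components independent of
the point of the torus has no differential along the torus. -/
theorem differential_torus_eq_zero {f : M × UnitAddTorus (Fin m) → ℝ}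
    (hf : ContMDiff (extModel I m) 𝓘(ℝ, ℝ) ∞ f) {x : M} {L : (Fin m → ℝ) → ℝ}
    (hL : ∀ θ κ, modelForm (differential (extModel I m) f) (x, θ) (0, κ) = L κ)
    (κ : Fin m → ℝ) : L κ = 0 := by
  obtain ⟨θ, hθ⟩ := exists_differential_torus_eq_zero hf x
  rw [← hL θ κ, hθ κ]

theorem hasDerivWithinAt_swirl {w : M → ℝ} {a : ℝ → M → ℝ} (hT : 0 < T)
    (ha : SmoothScalar I T a) {t : ℝ} (ht : t ∈ Icc 0 T) (x : M) :
    derivWithin (fun τ => (w x * a τ x) ^ 2 / 2) (Icc 0 T) t =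
      w x * a t x * (w x * derivWithin (fun τ => a τ x) (Icc 0 T) t) := by
  have h := ((((ha.hasDerivWithinAt ht x).const_mul (w x)).pow 2).div_const 2).derivWithin
    (uniqueDiffOn_Icc hT t ht)
  refine h.trans ?_
  simp
  ring

theorem solvesBoussinesq_of_extendsToEulerFlow (hT : 0 < T) {g : Metric I M}
    {u : ℝ → VField I M} (hu : IsFlow T u) (h : ExtendsToEulerFlow g T u) :
    ∃ (m : ℕ) (γ : Fin m → M → ℝ) (ρ : Fin m → ℝ → M → ℝ) (P : ℝ → M → ℝ),
        (∀ s, ContMDiff I 𝓘(ℝ, ℝ) ∞ (γ s)) ∧ (∀ s, SmoothScalar I T (ρ s)) ∧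
        SmoothScalar I T P ∧ SolvesBoussinesq g T u γ ρ P := by
  obtain ⟨m, w, gt, a, hg, ha, -, p, hp, heq⟩ := h
  have hw0 := weight_pos hg
  -- Here $\gamma_s=g̃^{ss}$ is the inverse weight, $\rho_s$ is half the square of the lowered swirl
  -- $w_s a^s$, and the pressure is restricted to the slice $\theta=0$.
  refine ⟨m, fun s x => (w s x)⁻¹, fun s t x => (w s x * a s t x) ^ 2 / 2,
    fun t x => p t (x, 0), fun s => ?_, fun s => ?_, ?_, ?_⟩
  · exact fun x => (contDiffAt_inv ℝ (hw0 s x).ne').comp_contMDiffAt (hg.1 s x)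
  · exact ((smoothScalar_const (hg.1 s)).mul (ha s)).comp (φ := fun r => r ^ 2 / 2)
      fun _ _ _ => (contDiff_id.pow 2).div_const 2 |>.contDiffAt
  · have h1 : ContMDiff (𝓘(ℝ, ℝ).prod I) (𝓘(ℝ, ℝ).prod (extModel I m)) ∞
        (fun q : ℝ × M => (q.1, q.2, (0 : UnitAddTorus (Fin m)))) :=
      contMDiff_fst.prodMk (contMDiff_snd.prodMk contMDiff_const)
    exact ContMDiffOn.comp (g := fun q : ℝ × M × UnitAddTorus (Fin m) => p q.1 q.2) hp
      h1.contMDiffOn fun q hq => ⟨hq.1, mem_univ _⟩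
  · intro t ht x
    have hpt := hp.contMDiff ht
    -- The Euler equations paired with an arbitrary vector `(c, κ)`; only the pressure term sees
    -- `θ`.
    have key : ∀ (θ : UnitAddTorus (Fin m)) (c : E) (κ : Fin m → ℝ), _ :=
      fun θ c κ => (inner_euler_ext hT hg hu ha ht (x, θ) c κ).symm.trans
        ((eq_neg_gradient_iff gt (p t) (x, θ) _).1 (heq t ht (x, θ)).1 (c, κ))
    have hθ : ∀ κ : Fin m → ℝ, ∑ s, (w s x *
        (derivWithin (fun τ => a s τ x) (Icc 0 T) t +
          modelForm (differential I (a s t)) x (modelField (u t) x)) +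
          modelForm (differential I (w s)) x (modelField (u t) x) * a s t x) * κ s = 0 := by
      intro κ
      rw [← neg_eq_zero]
      refine differential_torus_eq_zero hpt (x := x) (L := fun κ => -∑ s, (w s x *
        (derivWithin (fun τ => a s τ x) (Icc 0 T) t +
          modelForm (differential I (a s t)) x (modelField (u t) x)) +
          modelForm (differential I (w s)) x (modelField (u t) x) * a s t x) * κ s) ?_ κ
      intro θ κ
      -- Subtracting the case `κ = 0`, in which the pressure term is zero, removes the terms along
      -- $M$ and isolates the torus equation.
      have h1 := key θ 0 κ
      have h2 := key θ 0 0
      rw [show ((0 : E), (0 : Fin m → ℝ)) = 0 from rfl, map_zero] at h2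
      simp only [Pi.zero_apply, mul_zero, Finset.sum_const_zero] at h2
      linarith
    have hθs : ∀ s, w s x * (derivWithin (fun τ => a s τ x) (Icc 0 T) t +
          modelForm (differential I (a s t)) x (modelField (u t) x)) +
          modelForm (differential I (w s)) x (modelField (u t) x) * a s t x = 0 := by
      intro s
      simpa [Pi.single_apply] using hθ (Pi.single s 1)
    have hwd : ∀ s, MDifferentiableAt I 𝓘(ℝ, ℝ) (w s) x := fun s =>
      (hg.1 s x).mdifferentiableAt (by simp)
    refine ⟨fun c => ?_, fun s => ?_⟩
    · have h1 := (key 0 c 0).trans (congrArg Neg.neg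
        (differential_prod_left (hpt.contMDiffAt.mdifferentiableAt (by simp)) c))
      simp only [Pi.zero_apply, mul_zero, Finset.sum_const_zero, add_zero] at h1
      refine Eq.trans ?_ h1
      rw [sub_eq_add_neg, ← Finset.sum_neg_distrib]
      congr 1
      refine Finset.sum_congr rfl fun s _ => ?_
      -- Since $d(1/w)=-dw/w^2$, the factor $w^2$ in $\rho$ cancels and leaves $-\tfrac12a^2\,dw$.
      have h2 := differential_comp (hwd s) (hasDerivAt_inv (hw0 s x).ne') c
      refine (congrArg (fun r => (w s x * a s t x) ^ 2 / 2 * r) h2).trans ?_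
      have := (hw0 s x).ne'
      field_simp
    · have had : MDifferentiableAt I 𝓘(ℝ, ℝ) (a s t) x :=
        ((ha s).contMDiff ht x).mdifferentiableAt (by simp)
      have h1 := differential_swirl (modelField (u t) x) (hwd s) had rfl
      refine (congrArg₂ (· + ·) (hasDerivWithinAt_swirl hT (ha s) ht x) h1).trans ?_
      -- Transport of $(wa)^2/2$ is $wa$ times transport of $wa$.
      linear_combination (w s x * a s t x) * hθs s

end EulerToBoussinesq

/-! ### Construction of the warped metric -/

section WarpedMetric

open Bundle

set_option linter.unusedSectionVars false
set_option synthInstance.maxHeartbeats 200000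

variable {E : Type*} [NormedAddCommGroup E] [NormedSpace ℝ E] [FiniteDimensional ℝ E]
  {H : Type*} [TopologicalSpace H] {I : ModelWithCorners ℝ E H} [I.Boundaryless]
  {M : Type*} [TopologicalSpace M] [ChartedSpace H M] [IsManifold I ∞ M] {m : ℕ} {T : ℝ}

/-- The unit ball of a positive definite form on a finite dimensional space is bounded. -/
theorem isVonNBounded_of_posDef {V : Type*} [NormedAddCommGroup V] [NormedSpace ℝ V]
    [FiniteDimensional ℝ V] (B : V →L[ℝ] V →L[ℝ] ℝ) (hB : ∀ v, v ≠ 0 → 0 < B v v) :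
    Bornology.IsVonNBounded ℝ {v : V | B v v < 1} := by
  rw [NormedSpace.isVonNBounded_iff, isBounded_iff_forall_norm_le]
  rcases subsingleton_or_nontrivial V with hV | hV
  · exact ⟨0, fun v _ => by rw [Subsingleton.elim v 0, norm_zero]⟩
  have hc : Continuous fun v => B v v := by fun_prop
  obtain ⟨e, he, hmin⟩ := (isCompact_sphere (0 : V) 1).exists_isMinOn
    (NormedSpace.sphere_nonempty.2 zero_le_one) hc.continuousOn
  have he0 : e ≠ 0 := by
    rintro rfl
    simp at he
  have hδ := hB e he0
  -- With $\delta$ the minimum of the form on the unit sphere, a norm above $1+1/\delta$ forces both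
  -- $\|v\|>1$ and $\delta\|v\|>1$, hence $B(v,v)\ge\delta\|v\|^2>1$.
  refine ⟨1 + 1 / B e e, fun v hv => ?_⟩
  by_contra! hlt
  have hv0 : 0 < ‖v‖ := lt_trans (by positivity) hlt
  have h1 : B e e ≤ B (‖v‖⁻¹ • v) (‖v‖⁻¹ • v) := hmin (by
    simp [norm_smul, hv0.ne'])
  simp only [map_smul, smul_apply, smul_eq_mul] at h1
  have h2 : B e e * ‖v‖ ^ 2 ≤ B v v := by
    calc B e e * ‖v‖ ^ 2 ≤ (‖v‖⁻¹ * (‖v‖⁻¹ * B v v)) * ‖v‖ ^ 2 := by gcongr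
      _ = B v v := by field_simp
  have h3 : 1 < B e e * ‖v‖ := by
    calc (1 : ℝ) < B e e * (1 + 1 / B e e) := by
          rw [mul_add, mul_one_div_cancel hδ.ne']; linarith
      _ ≤ _ := by gcongr
  have h4 : 1 < ‖v‖ := lt_of_le_of_lt (by linarith [one_div_pos.2 hδ]) hlt
  have h5 : B v v < 1 := hv
  nlinarith

/-- The square of the `s`-th coordinate on the second factor. -/
def coordForm (E : Type*) [NormedAddCommGroup E] [NormedSpace ℝ E] (s : Fin m) :
    (E × (Fin m → ℝ)) →L[ℝ] (E × (Fin m → ℝ)) →L[ℝ] ℝ :=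
  (ContinuousLinearMap.mul ℝ ℝ).bilinearComp
    ((ContinuousLinearMap.proj s).comp (ContinuousLinearMap.snd ℝ E (Fin m → ℝ)))
    ((ContinuousLinearMap.proj s).comp (ContinuousLinearMap.snd ℝ E (Fin m → ℝ)))

/-- The pullback of a bilinear form to a product along the first projection. -/
def pullFst (A : E →L[ℝ] E →L[ℝ] ℝ) (m : ℕ) :
    (E × (Fin m → ℝ)) →L[ℝ] (E × (Fin m → ℝ)) →L[ℝ] ℝ :=
  A.bilinearComp (ContinuousLinearMap.fst ℝ E (Fin m → ℝ)) (ContinuousLinearMap.fst ℝ E (Fin m → ℝ))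

/-- Pulling back is linear on a finite dimensional space, hence continuous and smooth. -/
theorem contDiff_pullFst : ContDiff ℝ ∞ (fun A : E →L[ℝ] E →L[ℝ] ℝ => pullFst A m) := by
  let L : (E →L[ℝ] E →L[ℝ] ℝ) →ₗ[ℝ] ((E × (Fin m → ℝ)) →L[ℝ] (E × (Fin m → ℝ)) →L[ℝ] ℝ) :=
    { toFun := fun A => pullFst A m
      map_add' := fun A B => rfl
      map_smul' := fun r A => rfl }
  exact ContinuousLinearMap.contDiff (𝕜 := ℝ) (E := E →L[ℝ] E →L[ℝ] ℝ)
    (F := (E × (Fin m → ℝ)) →L[ℝ] (E × (Fin m → ℝ)) →L[ℝ] ℝ)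
    (LinearMap.toContinuousLinearMap (𝕜 := ℝ) (E := E →L[ℝ] E →L[ℝ] ℝ)
      (F' := (E × (Fin m → ℝ)) →L[ℝ] (E × (Fin m → ℝ)) →L[ℝ] ℝ) L)

/-- The form `g_{ij} dx^i dx^j + ∑ s, w_s (dθ^s)^2` in the model space. -/
def warpedForm (g : Metric I M) (w : Fin m → M → ℝ) (z : M × UnitAddTorus (Fin m)) :
    (E × (Fin m → ℝ)) →L[ℝ] (E × (Fin m → ℝ)) →L[ℝ] ℝ :=
  pullFst (modelInner g z.1) m + ∑ s, w s z.1 • coordForm E s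

theorem warpedForm_apply (g : Metric I M) (w : Fin m → M → ℝ) (z : M × UnitAddTorus (Fin m))
    (v v' : E × (Fin m → ℝ)) : warpedForm g w z v v' =
      modelInner g z.1 v.1 v'.1 + ∑ s, w s z.1 * (v.2 s * v'.2 s) := by
  simp only [warpedForm, add_apply, sum_apply, smul_apply, smul_eq_mul]
  rfl

theorem warpedForm_pos (g : Metric I M) {w : Fin m → M → ℝ} (hw : ∀ s x, 0 < w s x)
    (z : M × UnitAddTorus (Fin m)) (v : E × (Fin m → ℝ)) (hv : v ≠ 0) :
    0 < warpedForm g w z v v := by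
  rw [warpedForm_apply]
  have h0 : ∀ s ∈ Finset.univ, 0 ≤ w s z.1 * (v.2 s * v.2 s) := fun s _ =>
    mul_nonneg (hw s z.1).le (mul_self_nonneg _)
  by_cases h : v.1 = 0
  · have h2 : v.2 ≠ 0 := fun h2 => hv (Prod.ext h h2)
    obtain ⟨s, hs⟩ := Function.ne_iff.1 h2
    rw [h, map_zero, zero_add]
    exact Finset.sum_pos' h0 ⟨s, Finset.mem_univ s,
      mul_pos (hw s z.1) (mul_self_pos.2 hs)⟩
  · exact add_pos_of_pos_of_nonneg (modelInner_pos g z.1 v.1 h) (Finset.sum_nonneg h0)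

/-- In a product chart the frame along the torus is constant, so only the metric of $M$ and the
weights vary. -/
theorem contMDiffAt_bilinCoord_warpedForm (g : Metric I M) {w : Fin m → M → ℝ}
    (hw : ∀ s, ContMDiff I 𝓘(ℝ, ℝ) ∞ (w s)) (z : M × UnitAddTorus (Fin m)) :
    ContMDiffAt (extModel I m)
      𝓘(ℝ, (E × (Fin m → ℝ)) →L[ℝ] (E × (Fin m → ℝ)) →L[ℝ] ℝ) ∞
      (bilinCoord (warpedForm g w) (extModel I m) z) z := by
  have h1 : ContMDiffAt (extModel I m)
      𝓘(ℝ, (E × (Fin m → ℝ)) →L[ℝ] (E × (Fin m → ℝ)) →L[ℝ] ℝ) ∞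
      (fun p => pullFst (bilinCoord (modelInner g) I z.1 p.1) m +
        ∑ s, w s p.1 • coordForm E s) z := by
    have h2 : ∀ s, ContMDiffAt (extModel I m)
        𝓘(ℝ, (E × (Fin m → ℝ)) →L[ℝ] (E × (Fin m → ℝ)) →L[ℝ] ℝ) ∞
        (fun p => w s p.1 • coordForm E s) z := fun s =>
      ContMDiffAt.smul (f := fun p : M × UnitAddTorus (Fin m) => w s p.1)
        (g := fun _ => coordForm E s) ((hw s z.1).comp z contMDiffAt_fst) contMDiffAt_const
    refine ContMDiffAt.add (f := fun p : M × UnitAddTorus (Fin m) =>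
        pullFst (bilinCoord (modelInner g) I z.1 p.1) m)
      (g := fun p => ∑ s, w s p.1 • coordForm E s) ?_ ?_
    · exact (contDiff_pullFst (E := E) (m := m)).contDiffAt.comp_contMDiffAt
        ((contMDiffAt_bilinCoord_metric g z.1).comp z contMDiffAt_fst)
    · exact contMDiffAt_finsetSum (f := fun s (p : M × UnitAddTorus (Fin m)) =>
        w s p.1 • coordForm E s) fun s _ => h2 s
  refine h1.congr_of_eventuallyEq ?_
  filter_upwards [(chartAt (ModelProd H (Fin m → ℝ)) z).open_source.mem_nhds
    (mem_chart_source _ z)] with p hp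
  rw [prodChartedSpace_chartAt] at hp
  refine ContinuousLinearMap.ext fun v => ContinuousLinearMap.ext fun v' => ?_
  rw [bilinCoord_apply, warpedForm_apply]
  have h3 : ∀ v : E × (Fin m → ℝ), modelFrame (extModel I m) z p v =
      (modelFrame I z.1 p.1 v.1, v.2) := fun v => modelFrame_prod (I := I) hp.1 hp.2 v.1 v.2
  simp only [h3, add_apply, sum_apply, smul_apply, smul_eq_mul]
  rfl

/-- The metric `g_{ij} dx^i dx^j + ∑ s, w_s (dθ^s)^2` on `M × (ℝ/ℤ)^m`. -/
def warpedMetric (g : Metric I M) (w : Fin m → M → ℝ) (hw : ∀ s, ContMDiff I 𝓘(ℝ, ℝ) ∞ (w s))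
    (hw0 : ∀ s x, 0 < w s x) : Metric (extModel I m) (M × UnitAddTorus (Fin m)) where
  inner z := warpedForm g w z
  symm z v v' := by
    refine (warpedForm_apply g w z v v').trans (Eq.trans ?_ (warpedForm_apply g w z v' v).symm)
    rw [modelInner_symm]
    simp only [mul_comm]
  pos z v hv := warpedForm_pos g hw0 z v hv
  isVonNBounded z := isVonNBounded_of_posDef (warpedForm g w z) (warpedForm_pos g hw0 z)
  contMDiff z := (contMDiffAt_bilin_iff (I := extModel I m) (warpedForm g w) z).2
    (contMDiffAt_bilinCoord_warpedForm g hw z)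

theorem isExtensionMetric_warpedMetric (g : Metric I M) (w : Fin m → M → ℝ)
    (hw : ∀ s, ContMDiff I 𝓘(ℝ, ℝ) ∞ (w s)) (hw0 : ∀ s x, 0 < w s x)
    (hw1 : ∀ x, ∏ s, w s x = 1) : IsExtensionMetric g w (warpedMetric g w hw hw0) :=
  ⟨hw, hw1, fun x θ v v' η η' => warpedForm_apply g w (x, θ) (v, η) (v', η')⟩

end WarpedMetric

/-! ### From the Boussinesq system to an extended Euler flow -/

section BoussinesqToEuler

open Bundle

set_option linter.unusedSectionVars false
set_option synthInstance.maxHeartbeats 200000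

variable {E : Type*} [NormedAddCommGroup E] [NormedSpace ℝ E] [FiniteDimensional ℝ E]
  {H : Type*} [TopologicalSpace H] {I : ModelWithCorners ℝ E H} [I.Boundaryless]
  {M : Type*} [TopologicalSpace M] [ChartedSpace H M] [IsManifold I ∞ M] {m : ℕ} {T : ℝ}

/-- With a pressure lifted from $M$ there is no pressure gradient along the torus, so the Euler
equations reduce to `hM` and `hθ`. -/
theorem extendsToEulerFlow_of_warped (hT : 0 < T) {g : Metric I M} {u : ℝ → VField I M}
    (hu : IsIncompressibleFlow g T u) {w : Fin m → M → ℝ}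
    (hw : ∀ s, ContMDiff I 𝓘(ℝ, ℝ) ∞ (w s)) (hw0 : ∀ s x, 0 < w s x)
    (hw1 : ∀ x, ∏ s, w s x = 1) {a : Fin m → ℝ → M → ℝ} (ha : ∀ s, SmoothScalar I T (a s))
    {P : ℝ → M → ℝ} (hP : SmoothScalar I T P)
    (hM : ∀ t ∈ Icc 0 T, ∀ (x : M) (c : E),
      timeDerivForm T (fun τ => flat g (u τ)) t x c + covDerivForm g (flat g (u t)) x (u t x) c -
        ∑ s, a s t x ^ 2 / 2 * modelForm (differential I (w s)) x c =
          -modelForm (differential I (P t)) x c)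
    (hθ : ∀ t ∈ Icc 0 T, ∀ (x : M) (s : Fin m),
      w s x * (derivWithin (fun τ => a s τ x) (Icc 0 T) t +
        modelForm (differential I (a s t)) x (modelField (u t) x)) +
        modelForm (differential I (w s)) x (modelField (u t) x) * a s t x = 0) :
    ExtendsToEulerFlow g T u := by
  have hg := isExtensionMetric_warpedMetric g w hw hw0 hw1
  refine ⟨m, w, warpedMetric g w hw hw0, a, hg, ha, hu.1.extendedFlow ha,
    fun t z => P t z.1, ?_, fun t ht z => ⟨?_, ?_⟩⟩
  · have hp : ContMDiff (𝓘(ℝ, ℝ).prod (extModel I m)) (𝓘(ℝ, ℝ).prod I) ∞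
        (fun q : ℝ × M × UnitAddTorus (Fin m) => (q.1, q.2.1)) :=
      contMDiff_fst.prodMk (contMDiff_fst.comp contMDiff_snd)
    exact ContMDiffOn.comp (g := fun q : ℝ × M => P q.1 q.2) hP hp.contMDiffOn
      fun q hq => ⟨hq.1, mem_univ _⟩
  · refine (eq_neg_gradient_iff (E := E × (Fin m → ℝ)) (I := extModel I m) _
      (fun z : M × UnitAddTorus (Fin m) => P t z.1) z _).2 ?_
    rintro ⟨c, κ⟩
    refine (inner_euler_ext hT hg hu.1 ha ht z c κ).trans ?_
    rw [differential_comp_fst ((hP.contMDiff ht).contMDiffAt.mdifferentiableAt (by simp)),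
      ← hM t ht z.1 c]
    simp only [hθ t ht z.1, zero_mul, Finset.sum_const_zero, add_zero]
  · rw [extendedFlow_apply, divergence_ext hg (hu.1.contMDiff ht).contMDiffAt
      fun s => ((ha s).contMDiff ht).contMDiffAt]
    exact hu.2 t ht z.1

theorem differential_const (r : ℝ) (x : M) (v : E) :
    modelForm (differential I (fun _ => r)) x v = 0 := by
  rw [differential_eq mdifferentiableAt_const (hasFDerivAt_const r _), zero_apply]

theorem extendsToEulerFlow_of_pos (hT : 0 < T) {g : Metric I M} {u : ℝ → VField I M}
    (hu : IsIncompressibleFlow g T u) {γ : Fin m → M → ℝ} {ρ : Fin m → ℝ → M → ℝ}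
    {P : ℝ → M → ℝ} (hγ : ∀ s, ContMDiff I 𝓘(ℝ, ℝ) ∞ (γ s)) (hρ : ∀ s, SmoothScalar I T (ρ s))
    (hP : SmoothScalar I T P) (hγ0 : ∀ s x, 0 < γ s x) (hρ0 : ∀ s, ∀ t ∈ Icc 0 T, ∀ x, 0 < ρ s t x)
    (h : SolvesBoussinesq g T u γ ρ P) : ExtendsToEulerFlow g T u := by
  have hr : ∀ s, SmoothScalar I T (fun t x => Real.sqrt (2 * ρ s t x)) := fun s =>
    (hρ s).comp (φ := fun r => Real.sqrt (2 * r)) fun t ht x =>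
      (contDiffAt_const.mul contDiffAt_id).sqrt (by have := hρ0 s t ht x; simp [this.ne'])
  have hγd : ∀ s x, MDifferentiableAt I 𝓘(ℝ, ℝ) (γ s) x := fun s x =>
    (hγ s x).mdifferentiableAt (by simp)
  -- The swirls solve $(w_s a^s)^2/2=\rho_s$ with $w_s=1/\gamma_s$. The circle with index 0 has
  -- weight $\prod\gamma_s$, which normalizes the product, and zero swirl.
  refine extendsToEulerFlow_of_warped (m := m + 1) hT hu
    (w := Fin.cons (fun x => ∏ s, γ s x) fun s x => (γ s x)⁻¹)
    (a := Fin.cons (fun _ _ => 0) fun s t x => Real.sqrt (2 * ρ s t x) * γ s x)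
    (P := P) ?_ ?_ ?_ ?_ hP ?_ ?_
  · refine Fin.forall_fin_succ.2 ⟨?_, fun s => ?_⟩
    · change ContMDiff I 𝓘(ℝ, ℝ) ∞ fun x => ∏ s, γ s x
      exact contMDiff_finsetProd fun s _ => hγ s
    · exact fun x => (contDiffAt_inv ℝ (hγ0 s x).ne').comp_contMDiffAt (hγ s x)
  · refine Fin.forall_fin_succ.2 ⟨fun x => ?_, fun s x => ?_⟩
    · change 0 < ∏ s, γ s x
      exact Finset.prod_pos fun s _ => hγ0 s x
    · exact inv_pos.2 (hγ0 s x)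
  · intro x
    rw [Fin.prod_univ_succ]
    simp only [Fin.cons_zero, Fin.cons_succ]
    rw [← Finset.prod_mul_distrib]
    exact Finset.prod_eq_one fun s _ => mul_inv_cancel₀ (hγ0 s x).ne'
  · refine Fin.forall_fin_succ.2 ⟨?_, fun s => ?_⟩
    · exact smoothScalar_const contMDiff_const
    · exact (hr s).mul (smoothScalar_const (hγ s))
  · intro t ht x c
    refine Eq.trans ?_ ((h t ht x).1 c)
    rw [sub_eq_add_neg, Fin.sum_univ_succ]
    simp only [Fin.cons_zero, Fin.cons_succ]
    congr 1
    rw [zero_pow two_ne_zero, zero_div, zero_mul, zero_add, ← Finset.sum_neg_distrib]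
    refine Finset.sum_congr rfl fun s _ => ?_
    have h0 := (hγ0 s x).ne'
    rw [differential_comp (hγd s x) (hasDerivAt_inv h0) c, mul_pow,
      Real.sq_sqrt (by linarith [hρ0 s t ht x])]
    refine Eq.trans ?_ (rfl : ρ s t x * modelForm (differential I (γ s)) x c = _)
    field_simp
  · intro t ht x
    refine Fin.forall_fin_succ.2 ⟨?_, fun s => ?_⟩
    · simp only [Fin.cons_zero]
      refine (congrArg (fun r => _ * (_ + r) + _) (differential_const 0 x _)).trans ?_
      simp
    · simp only [Fin.cons_succ]
      have h0 := (hγ0 s x).ne'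
      have hρt := hρ0 s t ht x
      have hsq : HasDerivAt (fun r => Real.sqrt (2 * r)) (2 / (2 * Real.sqrt (2 * ρ s t x)))
          (ρ s t x) := by
        have := ((hasDerivAt_id (ρ s t x)).const_mul 2).sqrt (by simp [hρt.ne'])
        simpa using this
      have hrd := differential_comp (((hρ s).contMDiff ht x).mdifferentiableAt (by simp)) hsq
        (modelField (u t) x)
      have ht1 : derivWithin (fun τ => Real.sqrt (2 * ρ s τ x) * γ s x) (Icc 0 T) t =
          2 / (2 * Real.sqrt (2 * ρ s t x)) * derivWithin (fun τ => ρ s τ x) (Icc 0 T) t *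
            γ s x :=
        ((HasDerivAt.comp_hasDerivWithinAt (h₂ := fun r => Real.sqrt (2 * r)) t hsq
          ((hρ s).hasDerivWithinAt ht x)).mul_const
          (γ s x)).derivWithin (uniqueDiffOn_Icc hT t ht)
      have hx1 := differential_mul (((hr s).contMDiff ht x).mdifferentiableAt (by simp)) (hγd s x)
        (modelField (u t) x)
      have h2 : derivWithin (fun τ => ρ s τ x) (Icc 0 T) t +
          modelForm (differential I (ρ s t)) x (modelField (u t) x) = 0 := (h t ht x).2 s
      -- The derivatives of $\gamma$ and $1/\gamma$ cancel because $w_s a^s=\sqrt{2\rho_s}$; what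
      -- remains is the transport of $\rho_s$.
      rw [ht1, hx1, hrd, differential_comp (hγd s x) (hasDerivAt_inv h0)]
      have h3 : derivWithin (fun τ => ρ s τ x) (Icc 0 T) t =
          -modelForm (differential I (ρ s t)) x (modelField (u t) x) := by linarith
      rw [h3]
      field_simp
      ring

/-- Only $d\gamma_s$ enters, so `C` is harmless; `D` adds the exact form $d\sum D_s\gamma_s$, which
the new pressure compensates, and constants are transported. -/
theorem SolvesBoussinesq.shift (hT : 0 < T) {g : Metric I M} {u : ℝ → VField I M}
    {γ : Fin m → M → ℝ} {ρ : Fin m → ℝ → M → ℝ} {P : ℝ → M → ℝ}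
    (hγ : ∀ s, ContMDiff I 𝓘(ℝ, ℝ) ∞ (γ s)) (hρ : ∀ s, SmoothScalar I T (ρ s))
    (hP : SmoothScalar I T P) (h : SolvesBoussinesq g T u γ ρ P) (C D : Fin m → ℝ) :
    SolvesBoussinesq g T u (fun s x => γ s x + C s) (fun s t x => ρ s t x + D s)
      (fun t x => P t x + ∑ s, γ s x * -D s) := by
  have hγd : ∀ s x, MDifferentiableAt I 𝓘(ℝ, ℝ) (γ s) x := fun s x =>
    (hγ s x).mdifferentiableAt (by simp)
  intro t ht x
  have hadd : ∀ {f : M → ℝ}, MDifferentiableAt I 𝓘(ℝ, ℝ) f x → ∀ (r : ℝ) (v : E),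
      modelForm (differential I (fun p => f p + r)) x v = modelForm (differential I f) x v :=
    fun hf r v => by
      rw [differential_add hf mdifferentiableAt_const, differential_const, add_zero]
  refine ⟨fun c => ?_, fun s => ?_⟩
  · have hsum : ContMDiff I 𝓘(ℝ, ℝ) ∞ fun p => ∑ s, γ s p * -D s :=
      contMDiff_finsetSum fun s _ => (hγ s).mul contMDiff_const
    have h1 : ∀ c : E, modelForm (differential I (fun p => ∑ s, γ s p * -D s)) x c =
        ∑ s, modelForm (differential I (γ s)) x c * -D s := by
      intro c
      rw [differential_eq (hsum.contMDiffAt.mdifferentiableAt (by simp))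
        (HasFDerivAt.fun_sum (u := Finset.univ) fun s _ =>
          (hasFDerivAt_comp_chart (hγd s x)).mul_const (-D s))]
      rw [sum_apply]
      exact Finset.sum_congr rfl fun s _ => by rw [smul_apply, smul_eq_mul, mul_comm]
    have h2 := differential_add (((hP.contMDiff ht) x).mdifferentiableAt (by simp))
      (hsum.contMDiffAt.mdifferentiableAt (by simp)) c
    replace h2 := h2.trans (congrArg (_ + ·) (h1 c))
    have h3 : ∑ s, (ρ s t x + D s) * differential I (fun p => γ s p + C s) x c =
        ∑ s, ρ s t x * differential I (γ s) x c -
          ∑ s, modelForm (differential I (γ s)) x c * -D s := by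
      rw [← Finset.sum_sub_distrib]
      refine Finset.sum_congr rfl fun s _ => ?_
      refine (congrArg (fun r => (ρ s t x + D s) * r) (hadd (hγd s x) (C s) c)).trans ?_
      refine Eq.trans ?_ (rfl : ρ s t x * modelForm (differential I (γ s)) x c - _ = _)
      ring
    refine Eq.trans ?_ (congrArg Neg.neg h2.symm)
    have h4 := (h t ht x).1 c
    rw [neg_add]
    refine Eq.trans ?_ (congrArg (· + _) h4)
    rw [h3]
    ring
  · have h1 : derivWithin (fun τ => ρ s τ x + D s) (Icc 0 T) t =
        derivWithin (fun τ => ρ s τ x) (Icc 0 T) t :=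
      (((hρ s).hasDerivWithinAt ht x).add_const (D s)).derivWithin (uniqueDiffOn_Icc hT t ht)
    exact (congrArg₂ (· + ·) h1
      (hadd (((hρ s).contMDiff ht x).mdifferentiableAt (by simp)) (D s) _)).trans ((h t ht x).2 s)

theorem SmoothScalar.exists_add_pos [CompactSpace M] {f : ℝ → M → ℝ} (hf : SmoothScalar I T f) :
    ∃ C : ℝ, ∀ t ∈ Icc 0 T, ∀ x, 0 < f t x + C := by
  obtain ⟨C, hC⟩ := ((isCompact_Icc (a := (0 : ℝ)) (b := T)).prod
    (isCompact_univ (X := M))).exists_bound_of_continuousOn hf.continuousOn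
  refine ⟨C + 1, fun t ht x => ?_⟩
  have h := neg_le_of_abs_le (hC (t, x) ⟨ht, mem_univ x⟩)
  dsimp only at h
  linarith

theorem extendsToEulerFlow_of_solvesBoussinesq [CompactSpace M] (hT : 0 < T) {g : Metric I M}
    {u : ℝ → VField I M} (hu : IsIncompressibleFlow g T u) {γ : Fin m → M → ℝ}
    {ρ : Fin m → ℝ → M → ℝ} {P : ℝ → M → ℝ} (hγ : ∀ s, ContMDiff I 𝓘(ℝ, ℝ) ∞ (γ s))
    (hρ : ∀ s, SmoothScalar I T (ρ s)) (hP : SmoothScalar I T P)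
    (h : SolvesBoussinesq g T u γ ρ P) : ExtendsToEulerFlow g T u := by
  -- Each $\gamma_s$ is treated as constant in time, so one compactness bound on $[0,T]\times M$
  -- serves both families.
  choose C hC using fun s => (smoothScalar_const (T := T) (hγ s)).exists_add_pos
  choose D hD using fun s => (hρ s).exists_add_pos
  have hs : ContMDiff I 𝓘(ℝ, ℝ) ∞ fun p => ∑ s, γ s p * -D s :=
    contMDiff_finsetSum fun s _ => (hγ s).mul contMDiff_const
  exact extendsToEulerFlow_of_pos hT hu (fun s => (hγ s).add contMDiff_const)
    (fun s => (hρ s).add (smoothScalar_const contMDiff_const))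
    (hP.add (smoothScalar_const hs)) (fun s x => hC s 0 ⟨le_rfl, hT.le⟩ x) hD
    (h.shift hT hγ hρ hP C D)

end BoussinesqToEuler

end EulerExt

end

theorem proposition2p2 {d : ℕ} {M : Type*} [TopologicalSpace M] [T2Space M] [CompactSpace M]
    [ChartedSpace (EuclideanSpace ℝ (Fin d)) M] [IsManifold (𝓡 d) ∞ M]
    (g : EulerExt.Metric (𝓡 d) M) {T : ℝ} (hT : 0 < T)
    (u : ℝ → EulerExt.VField (𝓡 d) M) (hu : EulerExt.IsIncompressibleFlow g T u) :
    EulerExt.ExtendsToEulerFlow g T u ↔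
      ∃ (m : ℕ) (γ : Fin m → M → ℝ) (ρ : Fin m → ℝ → M → ℝ) (P : ℝ → M → ℝ),
        (∀ s, ContMDiff (𝓡 d) 𝓘(ℝ, ℝ) ∞ (γ s)) ∧
        (∀ s, EulerExt.SmoothScalar (𝓡 d) T (ρ s)) ∧
        EulerExt.SmoothScalar (𝓡 d) T P ∧
        EulerExt.SolvesBoussinesq g T u γ ρ P :=
  ⟨EulerExt.solvesBoussinesq_of_extendsToEulerFlow hT hu.1,
    fun ⟨_, _, _, _, hγ, hρ, hP, h⟩ =>
      EulerExt.extendsToEulerFlow_of_solvesBoussinesq hT hu hγ hρ hP h⟩
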